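/- **Setting.** Let $d\ge 1$, $\boldsymbol\nu=(\nu_1,\dots,\nu_d)\in\mathbb C^d$ and $\boldsymbol\varsigma=(\varsigma_1,\dots,\varsigma_{d+1})\in\{+,-\}^{d+1}$, with the signs read as $\pm1$ in formulas. For $x>0$ let $J_{\boldsymbol\nu}(x;\boldsymbol\varsigma)$ be the Bessel function given by the rigorous interpretation of the formal integral $$\int_{\mathbb R_+^d} p_{\boldsymbol\nu}(\boldsymbol t)\,e^{ix\theta(\boldsymbol t;\boldsymbol\varsigma)}\,d\boldsymbol t,\qquad p_{\boldsymbol\nu}(\boldsymbol t)=\prod_{l=1}^d t_l^{\nu_l-1},\qquad \theta(\boldsymbol t;\boldsymbol\varsigma)=\varsigma_{d+1}t_1\cdots t_d+\sum_{l=1}^d\varsigma_l t_l^{-1},$$ which is defined as follows. For $h(\boldsymbol t)=\prod_l h_l(t_l)$ write $J_{\boldsymbol\nu}(x;\boldsymbol\varsigma;h)=\int_{\mathbb R_+^d}h\,p_{\boldsymbol\nu}\,e^{ix\theta}\,d\boldsymbol t$ (a formal symbol unless the integral converges absolutely). With $\boldsymbol e_l$ the $l$-th unit vector and $\boldsymbol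 e^d=(1,\dots,1)$, define the formal partial integrations, extended $\mathbb C[x^{-1}]$-linearly, $$\mathcal P_{+,l}J_{\boldsymbol\nu}(h)=\varsigma_l\varsigma_{d+1}J_{\boldsymbol\nu+\boldsymbol e^d+\boldsymbol e_l}(h)-\varsigma_l i(\nu_l+1)x^{-1}J_{\boldsymbol\nu+\boldsymbol e_l}(h)-\varsigma_l i x^{-1}J_{\boldsymbol\nu+\boldsymbol e_l}(t_l\partial_l h),$$ $$\mathcal P_{-,l}J_{\boldsymbol\nu}(h)=\varsigma_l\varsigma_{d+1}J_{\boldsymbol\nu-\boldsymbol e^d-\boldsymbol e_l}(h)+\varsigma_{d+1} i(\nu_l-1)x^{-1}J_{\boldsymbol\nu-\boldsymbol e^d}(h)+\varsigma_{d+1} i x^{-1}J_{\boldsymbol\nu-\boldsymbol e^d}(t_l\partial_l h).$$ Take a finite partition of unity $\{h_\varrho\}_{\varrho\in I}$, $\{+,-\}\subset I$, on $\mathbb R_+$ by smooth nonnegative functions with $t^\alpha h_\varrho^{(\alpha)}(t)$ bounded for every $\alpha\ge 0$, with $h_-=1$ near $0$ and $h_+=1$ near $\infty$, and an integer $A>\max_l|\mathrm{Re}\,\nu_l|+2$.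 For $\boldsymbol\varrho\in I^d$ put $h_{\boldsymbol\varrho}(\boldsymbol t)=\prod_l h_{\varrho_l}(t_l)$ and $L_\pm=\{l:\varrho_l=\pm\}$. If $L_+=\varnothing$, replace $J_{\boldsymbol\nu}(x;\boldsymbol\varsigma;h_{\boldsymbol\varrho})$ by $\prod_{l\in L_-}\mathcal P_{+,l}^{A}J_{\boldsymbol\nu}(x;\boldsymbol\varsigma;h_{\boldsymbol\varrho})$. If $L_+\neq\varnothing$, choose $l_+\in L_+$; if $L_-=\varnothing$, replace it by $\mathcal P_{-,l_+}^{A}J_{\boldsymbol\nu}(x;\boldsymbol\varsigma;h_{\boldsymbol\varrho})$; if $L_-\ne\varnothing$, apply $\prod_{l\in L_-}\mathcal P_{+,l}^{2A}$ and then $\mathcal P_{-,l_+}^{A+\alpha}$ to each resulting term of index $\boldsymbol\nu+\alpha\boldsymbol e^d+2A\sum_{l\in L_-}\boldsymbol e_l$. The resulting integrals converge absolutely, and $J_{\boldsymbol\nu}(x;\boldsymbol\varsigma)$ is the sum over $\boldsymbol\varrho\in I^d$ of the expressions so obtained. **Theorem.** Let $\mathfrak c=\max_l|\nu_l|+1$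 and $\mathfrak r=\max_l|\mathrm{Re}\,\nu_l|$, and suppose that one of the signs $\varsigma_1,\dots,\varsigma_d$ is different from $\varsigma_{d+1}$. Then, for every admissible choice of $\{h_\varrho\}$, $A$ and the $l_+$, the function $J_{\boldsymbol\nu}(x;\boldsymbol\varsigma)$ is smooth on $(0,\infty)$, and for all nonnegative integers $j$ and $M$ $$J^{(j)}_{\boldsymbol\nu}(x;\boldsymbol\varsigma)\ll_{\mathfrak r,M,j,d}\left(\frac{\mathfrak c}{x}\right)^{M}\qquad\text{for all }x\ge\mathfrak c,$$ where the implied constant depends only on $\mathfrak r$, $M$, $j$ and $d$. In particular, $J_{\boldsymbol\nu}(x;\boldsymbol\varsigma)$ is a Schwartz function at infinity: for all $j,N\ge 0$, $J^{(j)}_{\boldsymbol\nu}(x;\boldsymbol\varsigma)=O(x^{-N})$ as $x\to\infty$. -/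

import Mathlib

open Set Filter Topology MeasureTheory

open scoped ContDiff

noncomputable section

namespace FundamentalBessel

/-- The function space `𝒯(ℝ₊)` (real-valued members): smooth `h` on `(0, ∞)` such that
`t ^ α * h⁽ᵅ⁾(t)` is bounded on `(0, ∞)` for every order `α`.
Values of `h` outside `(0, ∞)` are irrelevant. -/
def MemT (h : ℝ → ℝ) : Prop :=
  ContDiffOn ℝ ∞ h (Ioi 0) ∧
    ∀ α : ℕ, ∃ B : ℝ, ∀ t : ℝ, 0 < t → |t ^ α * iteratedDeriv α h t| ≤ B

/-- The operator `h ↦ t ∂h`. -/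
def eulerOp (h : ℝ → ℝ) : ℝ → ℝ := fun t => t * deriv h t

/-- The sign `ς_l`, `1 ≤ l ≤ d`, as a complex number. -/
def sgn {d : ℕ} (ς : Fin (d + 1) → ℤˣ) (l : Fin d) : ℂ := ((ς l.castSucc : ℤ) : ℂ)

/-- The last sign `ς_{d+1}` as a complex number. -/
def sgnLast {d : ℕ} (ς : Fin (d + 1) → ℤˣ) : ℂ := ((ς (Fin.last d) : ℤ) : ℂ)

/-- The phase `θ(t; ς) = ς_{d+1} t_1 ⋯ t_d + ∑ ς_l t_l⁻¹`. -/
def phase {d : ℕ} (ς : Fin (d + 1) → ℤˣ) (t : Fin d → ℝ) : ℂ :=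
  sgnLast ς * ∏ l, (t l : ℂ) + ∑ l, sgn ς l * (t l : ℂ)⁻¹

/-- The power function `p_ν(t) = ∏ t_l ^ (ν_l - 1)`. -/
def powerFn {d : ℕ} (ν : Fin d → ℂ) (t : Fin d → ℝ) : ℂ :=
  ∏ l, (t l : ℂ) ^ (ν l - 1)

/-- The `J`-integral `J_ν(x; ς; h) = ∫_{ℝ₊^d} h(t) p_ν(t) e^{i x θ(t; ς)} dt`
with the product weight `h(t) = ∏ h_l(t_l)`. -/
def JIntegral {d : ℕ} (ν : Fin d → ℂ) (ς : Fin (d + 1) → ℤˣ) (h : Fin d → ℝ → ℝ) (x : ℝ) : ℂ :=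
  ∫ t in Set.pi univ (fun _ : Fin d => Ioi (0 : ℝ)),
    (∏ l, (h l (t l) : ℂ)) * powerFn ν t * Complex.exp (Complex.I * (x : ℂ) * phase ς t)

/-- A formal `J`-integral with coefficient: with respect to a base index `ν`, it stands for
`coeff * x ^ (-deg) * J_{ν + shift}(x; ς; ∏ h_l)`.  No convergence is required.
Formal `ℂ[x⁻¹]`-linear combinations of `J`-integrals are lists of such terms. -/
structure JTerm (d : ℕ) where
  coeff : ℂ
  deg : ℕ
  shift : Fin d → ℤ
  h : Fin d → ℝ → ℝ

/-- The value of a term (meaningful when its `J`-integral converges absolutely). -/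
def JTerm.eval {d : ℕ} (ν : Fin d → ℂ) (ς : Fin (d + 1) → ℤˣ) (x : ℝ) (T : JTerm d) : ℂ :=
  T.coeff * ((x : ℂ)⁻¹) ^ T.deg * JIntegral (fun l => ν l + (T.shift l : ℂ)) ς T.h x

/-- The formal partial integration of the first kind, `𝒫_{+, l}`:
`J_ν(h) ↦ ς_l ς_{d+1} J_{ν + e^d + e_l}(h) - ς_l i (ν_l + 1) x⁻¹ J_{ν + e_l}(h)
  - ς_l i x⁻¹ J_{ν + e_l}(t_l ∂_l h)`, where `e^d = (1, …, 1)`. -/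
def opPlus {d : ℕ} (ν : Fin d → ℂ) (ς : Fin (d + 1) → ℤˣ) (l : Fin d) (T : JTerm d) :
    List (JTerm d) :=
  [ { coeff := T.coeff * (sgn ς l * sgnLast ς)
      deg := T.deg
      shift := T.shift + 1 + Pi.single l 1
      h := T.h },
    { coeff := T.coeff * (-(sgn ς l * Complex.I * (ν l + (T.shift l : ℂ) + 1)))
      deg := T.deg + 1
      shift := T.shift + Pi.single l 1
      h := T.h },
    { coeff := T.coeff * (-(sgn ς l * Complex.I))
      deg := T.deg + 1
      shift := T.shift + Pi.single l 1
      h := Function.update T.h l (eulerOp (T.h l)) } ]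

/-- The formal partial integration of the second kind, `𝒫_{-, l}`:
`J_ν(h) ↦ ς_l ς_{d+1} J_{ν - e^d - e_l}(h) + ς_{d+1} i (ν_l - 1) x⁻¹ J_{ν - e^d}(h)
  + ς_{d+1} i x⁻¹ J_{ν - e^d}(t_l ∂_l h)`. -/
def opMinus {d : ℕ} (ν : Fin d → ℂ) (ς : Fin (d + 1) → ℤˣ) (l : Fin d) (T : JTerm d) :
    List (JTerm d) :=
  [ { coeff := T.coeff * (sgn ς l * sgnLast ς)
      deg := T.deg
      shift := T.shift - 1 - Pi.single l 1
      h := T.h },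
    { coeff := T.coeff * (sgnLast ς * Complex.I * (ν l + (T.shift l : ℂ) - 1))
      deg := T.deg + 1
      shift := T.shift - 1
      h := T.h },
    { coeff := T.coeff * (sgnLast ς * Complex.I)
      deg := T.deg + 1
      shift := T.shift - 1
      h := Function.update T.h l (eulerOp (T.h l)) } ]

/-- The `n`-th power of an operator given on terms, acting on formal sums. -/
def opPow {d : ℕ} (op : JTerm d → List (JTerm d)) (n : ℕ) : List (JTerm d) → List (JTerm d) :=
  (fun S => S.flatMap op)^[n]

/-- `∏_{l ∈ L} 𝒫_{+, l}^n` (the operators for different `l` commute, so that the order in which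
they are applied is immaterial). -/
def opPlusAll {d : ℕ} (ν : Fin d → ℂ) (ς : Fin (d + 1) → ℤˣ) (L : List (Fin d)) (n : ℕ)
    (S : List (JTerm d)) : List (JTerm d) :=
  L.foldl (fun S' l => opPow (opPlus ν ς l) n S') S

/-- The auxiliary data in the rigorous interpretation of the formal integral of index `ν`:
a finite partition of unity on `ℝ₊` by functions in `𝒯(ℝ₊)`, with a member `h neg` equal to `1`
near zero and a member `h pos` equal to `1` near infinity; an integer `A ≥ a + 2` for some `a`
with `|Re ν_l| < a` for all `l`; and a choice, for each multi-index `ϱ` for which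
`L₊(ϱ) = {l : ϱ_l = pos}` is not empty, of an element `sel ϱ` of `L₊(ϱ)`. -/
structure RegularizationData {d : ℕ} (ν : Fin d → ℂ) where
  ι : Type
  [fintype : Fintype ι]
  [decEq : DecidableEq ι]
  neg : ι
  pos : ι
  neg_ne_pos : neg ≠ pos
  h : ι → ℝ → ℝ
  memT : ∀ i, MemT (h i)
  nonneg : ∀ i, ∀ t : ℝ, 0 < t → 0 ≤ h i t
  sum_eq_one : ∀ t : ℝ, 0 < t → ∑ i, h i t = 1
  neg_eq_one : ∀ᶠ t in 𝓝[>] (0 : ℝ), h neg t = 1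
  pos_eq_one : ∀ᶠ t in atTop, h pos t = 1
  A : ℕ
  lt_A : ∀ l, |(ν l).re| + 2 < (A : ℝ)
  sel : (Fin d → ι) → Fin d
  sel_mem : ∀ ϱ : Fin d → ι, (∃ l, ϱ l = pos) → ϱ (sel ϱ) = pos

attribute [instance] RegularizationData.fintype RegularizationData.decEq

theorem memT_of_eventually_const {f : ℝ → ℝ} (hf : ContDiff ℝ ∞ f) {c : ℝ}
    (hc : ∀ t : ℝ, 2 ≤ t → f t = c) : MemT f := by
  refine ⟨hf.contDiffOn, fun α => ?_⟩
  have hcont : Continuous fun t : ℝ => t ^ α * iteratedDeriv α f t :=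
    (continuous_id.pow α).mul (hf.continuous_iteratedDeriv α (by exact_mod_cast le_top))
  obtain ⟨B, hB⟩ := (isCompact_Icc (a := (0 : ℝ)) (b := 3)).exists_bound_of_continuousOn
    hcont.continuousOn
  refine ⟨max B |c|, fun t ht => ?_⟩
  rcases le_or_gt t 3 with h3 | h3
  · exact le_max_of_le_left (hB t ⟨ht.le, h3⟩)
  · have he : f =ᶠ[𝓝 t] fun _ => c := by
      filter_upwards [lt_mem_nhds h3] with s hs
      exact hc s (by linarith)
    rw [he.iteratedDeriv_eq α, iteratedDeriv_const]
    apply le_max_of_le_right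
    by_cases h0 : α = 0 <;> simp [h0]

/-- Regularization data exist for every index. -/
theorem nonempty_regularizationData {d : ℕ} (hd : 0 < d) (ν : Fin d → ℂ) :
    Nonempty (RegularizationData ν) := by
  classical
  have hs : ContDiff ℝ ∞ fun t : ℝ => Real.smoothTransition (t - 1) :=
    Real.smoothTransition.contDiff.comp (contDiff_id.sub contDiff_const)
  obtain ⟨A, hA⟩ := exists_nat_gt (∑ l, |(ν l).re| + 2)
  refine ⟨{
    ι := Bool
    neg := false
    pos := true
    neg_ne_pos := by simp
    h := fun b t => if b then Real.smoothTransition (t - 1)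
      else 1 - Real.smoothTransition (t - 1)
    memT := ?_
    nonneg := ?_
    sum_eq_one := ?_
    neg_eq_one := ?_
    pos_eq_one := ?_
    A := A
    lt_A := ?_
    sel := fun ϱ => if h : ∃ l, ϱ l = true then h.choose else ⟨0, hd⟩
    sel_mem := ?_ }⟩
  · intro b
    cases b
    · simpa using memT_of_eventually_const (contDiff_const.sub hs) (c := 0) (f := fun t : ℝ =>
        1 - Real.smoothTransition (t - 1)) (fun t ht => by
          simp [Real.smoothTransition.one_of_one_le (show (1 : ℝ) ≤ t - 1 by linarith)])
    · simpa using memT_of_eventually_const hs (c := 1) (fun t ht =>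
        Real.smoothTransition.one_of_one_le (show (1 : ℝ) ≤ t - 1 by linarith))
  · intro b t _
    cases b
    · simpa using Real.smoothTransition.le_one (t - 1)
    · simpa using Real.smoothTransition.nonneg (t - 1)
  · intro t _
    simp
  · have h1 : ∀ᶠ t in 𝓝[>] (0 : ℝ), t < 1 :=
      nhdsWithin_le_nhds (gt_mem_nhds (show (0 : ℝ) < 1 by norm_num))
    filter_upwards [h1] with t ht
    simp [Real.smoothTransition.zero_of_nonpos (show t - 1 ≤ 0 by linarith)]
  · filter_upwards [eventually_ge_atTop (2 : ℝ)] with t ht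
    simp [Real.smoothTransition.one_of_one_le (show (1 : ℝ) ≤ t - 1 by linarith)]
  · intro l
    have := Finset.single_le_sum (f := fun l => |(ν l).re|) (fun i _ => abs_nonneg _)
      (Finset.mem_univ l)
    linarith
  · intro ϱ h
    rw [dif_pos h]
    exact h.choose_spec

/-- The formal sum of (absolutely convergent) `J`-integrals that replaces the formal integral
`J_ν(x; ς; h_ϱ)`, where `h_ϱ(t) = ∏ h_{ϱ_l}(t_l)`.  With `L₊ = {l : ϱ_l = pos}` and
`L₋ = {l : ϱ_l = neg}`:
* if `L₊` is empty, apply `∏_{l ∈ L₋} 𝒫_{+, l}^A` (nothing at all, when `L₋` is empty too);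
* otherwise, first apply `∏_{l ∈ L₋} 𝒫_{+, l}^{2A}`; each resulting term has index
  `ν + α e^d + 2A ∑_{l ∈ L₋} e_l` for some natural number `α`, which is its index shift at
  `l₊ = sel ϱ`; then apply `𝒫_{-, l₊}^{A + α}` to that term
  (when `L₋` is empty, this is just `𝒫_{-, l₊}^A`). -/
def regularizedPiece {d : ℕ} {ν : Fin d → ℂ} (R : RegularizationData ν)
    (ς : Fin (d + 1) → ℤˣ) (ϱ : Fin d → R.ι) : List (JTerm d) :=
  let S₀ : List (JTerm d) := [{ coeff := 1, deg := 0, shift := 0, h := fun l => R.h (ϱ l) }]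
  let Lneg : List (Fin d) := (List.finRange d).filter (fun l => ϱ l = R.neg)
  if ∃ l, ϱ l = R.pos then
    (opPlusAll ν ς Lneg (2 * R.A) S₀).flatMap (fun T =>
      opPow (opMinus ν ς (R.sel ϱ)) (R.A + (T.shift (R.sel ϱ)).toNat) [T])
  else
    opPlusAll ν ς Lneg R.A S₀

/-- The Bessel function `J_ν(x; ς)`, `x > 0`: the rigorous interpretation of the formal integral
`∫_{ℝ₊^d} p_ν(t) e^{i x θ(t; ς)} dt`, the sum over all `ϱ` of the regularized pieces. -/
def besselJ {d : ℕ} {ν : Fin d → ℂ} (R : RegularizationData ν) (ς : Fin (d + 1) → ℤˣ)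
    (x : ℝ) : ℂ :=
  ∑ ϱ : Fin d → R.ι, ((regularizedPiece R ς ϱ).map (JTerm.eval ν ς x)).sum

/-- `𝔠 = max |ν_l| + 1`. -/
def conductor {d : ℕ} (ν : Fin d → ℂ) : ℝ := (⨆ l, ‖ν l‖) + 1

/-- `𝔯 = max |Re ν_l|`. -/
def maxRe {d : ℕ} (ν : Fin d → ℂ) : ℝ := ⨆ l, |(ν l).re|

/-- All derivatives of `f` decay rapidly at infinity. -/
def IsSchwartzAtInfinity (f : ℝ → ℂ) : Prop :=
  ∀ j N : ℕ, iteratedDeriv j f =O[atTop] fun x : ℝ => (x ^ N)⁻¹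

end FundamentalBessel

end

noncomputable section

namespace FundamentalBessel

open Finset (sum_nonneg single_le_sum mem_univ)

variable {d : ℕ}

/-! The idea is contour rotation. In coordinates `t_l = e^{u_l + iφ_l}` the imaginary part of the
phase is `ς_{d+1} sin(∑ φ_l) e^{∑ u_l} - ∑ ς_l sin(φ_l) e^{-u_l}`. If every coefficient of an
exponential here is at least `b > 0` (`Damping`), the integrand decays like `exp(-x b spread u)` and
the unregularized integral converges absolutely. This requires `φ_l = -ς_l w_l` with small `w_l > 0`
and `ς_{d+1} ∑ φ_l > 0`; a sign `ς_k ≠ ς_{d+1}` allows it, by making `w_k` dominate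
(`exists_damping`).

The regularized definition agrees with the rotated integral for three reasons. On damping rays the
formal partial integrations are true identities, because the cut-offs depend on `|t_l|` only and the
derivatives are taken along the rays (`sum_rotEval_regularizedPiece`). As the angles `τφ` tend to
`0`, each final term converges by dominated convergence to its absolutely convergent `J`-integral
(`tendsto_rotEval`), and summing over the partition of unity removes the cut-offs
(`tendsto_rotJ_one`). Without cut-offs the integral does not depend on `τ` (`hasDerivAt_rotJ_arg`).
Hence `besselJ_eq_rotJ`.

Differentiation in `x` only brings down powers of the phase. Rotation costs a factor `exp(∑ |Im ν_l
φ_l|)`; angles of size `1/𝔠` keep it bounded and still give damping of order `1/𝔠`, hence decay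
`exp(-a x/𝔠)` with `a` depending only on `d` (`norm_momentJ_le`). -/

/-! ### Integrable majorants in logarithmic coordinates -/

/-- `e^{u_1 + ⋯ + u_d} + ∑ e^{-u_l}`, the size of the phase in logarithmic coordinates. -/
def spread (u : Fin d → ℝ) : ℝ := Real.exp (∑ l, u l) + ∑ l, Real.exp (-u l)

theorem continuous_spread : Continuous (spread (d := d)) := by
  unfold spread; fun_prop

theorem exp_sum_le_spread (u : Fin d → ℝ) : Real.exp (∑ l, u l) ≤ spread u :=
  le_add_of_nonneg_right (sum_nonneg fun _ _ => (Real.exp_pos _).le)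

theorem exp_neg_le_spread (u : Fin d → ℝ) (l : Fin d) : Real.exp (-u l) ≤ spread u :=
  (single_le_sum (f := fun l => Real.exp (-u l)) (fun _ _ => (Real.exp_pos _).le)
    (mem_univ l)).trans (le_add_of_nonneg_left (Real.exp_pos _).le)

theorem one_le_spread (u : Fin d → ℝ) : 1 ≤ spread u := by
  by_cases h : 0 ≤ ∑ l, u l
  · exact (Real.one_le_exp h).trans (exp_sum_le_spread u)
  · obtain ⟨l, -, hl⟩ : ∃ l ∈ Finset.univ, u l < 0 := by
      by_contra! hc
      exact h (sum_nonneg hc)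
    exact (Real.one_le_exp (by linarith)).trans (exp_neg_le_spread u l)

/-- The tangent-line bound `y + 1 ≤ e^y`, translated so that the slope becomes `c`. -/
theorem exists_mul_le_exp {a c : ℝ} (ha : 0 < a) (hc : 0 < c) :
    ∃ K : ℝ, 0 ≤ K ∧ ∀ y : ℝ, c * y ≤ a * Real.exp y + K := by
  refine ⟨|c * (-Real.log (a / c) - 1)|, abs_nonneg _, fun y => ?_⟩
  have h := Real.add_one_le_exp (y + Real.log (a / c))
  rw [Real.exp_add, Real.exp_log (div_pos ha hc)] at h
  have h1 : c * (y + Real.log (a / c) + 1) ≤ a * Real.exp y := by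
    calc _ ≤ c * (Real.exp y * (a / c)) := mul_le_mul_of_nonneg_left h hc.le
      _ = _ := by field_simp
  have h2 := le_abs_self (c * (-Real.log (a / c) - 1))
  linarith

theorem pow_mul_exp_neg_le {a y : ℝ} (ha : 0 < a) (hy : 0 ≤ y) (n : ℕ) :
    y ^ n * Real.exp (-(a * y)) ≤ n.factorial / a ^ n := by
  have h := Real.pow_div_factorial_le_exp (a * y) (by positivity) n
  rw [div_le_iff₀ (by positivity), mul_pow] at h
  rw [Real.exp_neg, ← div_eq_mul_inv, div_le_div_iff₀ (Real.exp_pos _) (by positivity)]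
  linarith

/-- A dominating function for all integrands in logarithmic coordinates. -/
def weight (r : ℝ) (n : ℕ) (b : ℝ) (u : Fin d → ℝ) : ℝ :=
  Real.exp (r * ∑ l, |u l|) * spread u ^ n * Real.exp (-(b * spread u))

theorem continuous_weight (r : ℝ) (n : ℕ) (b : ℝ) : Continuous (weight (d := d) r n b) := by
  have := continuous_spread (d := d)
  unfold weight; fun_prop

theorem weight_nonneg (r : ℝ) (n : ℕ) (b : ℝ) (u : Fin d → ℝ) : 0 ≤ weight r n b u := by
  have := one_le_spread u
  unfold weight; positivity

theorem weight_anti {b b' : ℝ} (h : b ≤ b') (r : ℝ) (n : ℕ) (u : Fin d → ℝ) :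
    weight r n b' u ≤ weight r n b u := by
  have := one_le_spread u
  unfold weight
  gcongr

theorem integrable_exp_neg_abs : Integrable fun u : ℝ => Real.exp (-|u|) := by
  rw [← integrableOn_univ, ← Iic_union_Ioi (a := (0 : ℝ))]
  refine IntegrableOn.union ?_ ?_
  · refine (integrableOn_exp_Iic 0).congr_fun (fun u hu => ?_) measurableSet_Iic
    simp [abs_of_nonpos (mem_Iic.1 hu)]
  · refine (exp_neg_integrableOn_Ioi 0 one_pos).congr_fun (fun u hu => ?_) measurableSet_Ioi
    simp [abs_of_pos (mem_Ioi.1 hu)]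

theorem integrable_prod_exp_neg_abs :
    Integrable fun u : Fin d → ℝ => ∏ l, Real.exp (-|u l|) :=
  Integrable.fintype_prod (fun _ => integrable_exp_neg_abs)

/-- Since `|u_l| = u_l + 2 max(-u_l, 0)`, the sum `∑ |u_l|` is controlled by positive multiples of
`∑ u_l` and of the negative parts, each dominated by an exponential in `spread u`. Half of the decay
pays for the linear exponent, the other half for the power. -/
theorem integrable_weight (r : ℝ) (n : ℕ) {b : ℝ} (hb : 0 < b) :
    Integrable (weight (d := d) r n b) := by
  -- The extra `1` leaves the integrable factor `∏ exp(-|u_l|)`.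
  set R : ℝ := |r| + 1 with hR
  have hR0 : 0 < R := by positivity
  obtain ⟨K₁, hK₁, h₁⟩ := exists_mul_le_exp (a := b / 2) (c := R) (by positivity) hR0
  obtain ⟨K₂, hK₂, h₂⟩ := exists_mul_le_exp (a := b / 2) (c := 2 * R) (by positivity) (by positivity)
  have key : ∀ u : Fin d → ℝ, R * ∑ l, |u l| ≤ b / 2 * spread u + (K₁ + d * K₂) := by
    intro u
    have e1 : R * ∑ l, |u l| = R * ∑ l, u l + ∑ l, 2 * R * max (-u l) 0 := by
      rw [Finset.mul_sum, Finset.mul_sum, ← Finset.sum_add_distrib]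
      refine Finset.sum_congr rfl fun l _ => ?_
      rcases le_total 0 (u l) with h | h
      · rw [abs_of_nonneg h, max_eq_right (by linarith)]; ring
      · rw [abs_of_nonpos h, max_eq_left (by linarith)]; ring
    have e2 : ∑ l, 2 * R * max (-u l) 0 ≤ ∑ l, (b / 2 * Real.exp (-u l) + K₂) := by
      refine Finset.sum_le_sum fun l _ => ?_
      rcases le_total 0 (-u l) with h | h
      · rw [max_eq_left h]; exact h₂ _
      · rw [max_eq_right h]; simp; positivity
    have e4 : ∑ l, (b / 2 * Real.exp (-u l) + K₂) = b / 2 * ∑ l, Real.exp (-u l) + d * K₂ := by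
      simp [Finset.sum_add_distrib, Finset.mul_sum]
    have e3 := h₁ (∑ l, u l)
    unfold spread
    linarith
  have hB := (integrable_prod_exp_neg_abs (d := d)).const_mul
    (Real.exp (K₁ + d * K₂) * (n.factorial / (b / 2) ^ n))
  refine hB.mono' (continuous_weight r n b).aestronglyMeasurable (ae_of_all _ fun u => ?_)
  rw [Real.norm_of_nonneg (weight_nonneg _ _ _ _)]
  have hp := pow_mul_exp_neg_le (half_pos hb) (zero_le_one.trans (one_le_spread u)) n
  have hs : 0 ≤ ∑ l, |u l| := sum_nonneg fun _ _ => abs_nonneg _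
  have e : Real.exp (r * ∑ l, |u l|) * Real.exp (-(b / 2 * spread u)) ≤
      Real.exp (K₁ + d * K₂) * ∏ l, Real.exp (-|u l|) := by
    rw [← Real.exp_sum, ← Real.exp_add, ← Real.exp_add, Real.exp_le_exp, Finset.sum_neg_distrib]
    have := key u
    have : r * ∑ l, |u l| ≤ |r| * ∑ l, |u l| := mul_le_mul_of_nonneg_right (le_abs_self r) hs
    rw [hR] at *
    linarith
  calc weight r n b u = (Real.exp (r * ∑ l, |u l|) * Real.exp (-(b / 2 * spread u))) *
        (spread u ^ n * Real.exp (-(b / 2 * spread u))) := by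
        unfold weight
        rw [show -(b * spread u) = -(b / 2 * spread u) + -(b / 2 * spread u) by ring, Real.exp_add]
        ring
    _ ≤ (Real.exp (K₁ + d * K₂) * ∏ l, Real.exp (-|u l|)) * (n.factorial / (b / 2) ^ n) := by
        gcongr
        have := one_le_spread u
        positivity
    _ = _ := by ring

/-! ### Rotated integrals and damping -/

/-- The point with logarithmic coordinates `u` moved to the ray of arguments `φ`. -/
def rotate (φ u : Fin d → ℝ) : Fin d → ℂ := fun l => u l + φ l * Complex.I

/-- The phase in logarithmic coordinates. -/
def logPhase (ς : Fin (d + 1) → ℤˣ) (v : Fin d → ℂ) : ℂ :=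
  sgnLast ς * Complex.exp (∑ l, v l) + ∑ l, sgn ς l * Complex.exp (-v l)

/-- The integrand `p_ν(t) e^{i x θ(t; ς)} t_1 ⋯ t_d` in logarithmic coordinates. -/
def kern (ν : Fin d → ℂ) (ς : Fin (d + 1) → ℤˣ) (x : ℝ) (v : Fin d → ℂ) : ℂ :=
  Complex.exp (∑ l, ν l * v l + Complex.I * x * logPhase ς v)

/-- The `J`-integral over the rays of arguments `φ`, with weight functions `h_l(|t_l|)`. -/
def rotJ (ν : Fin d → ℂ) (ς : Fin (d + 1) → ℤˣ) (φ : Fin d → ℝ) (h : Fin d → ℝ → ℝ) (x : ℝ) : ℂ :=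
  ∫ u : Fin d → ℝ, (∏ l, (h l (Real.exp (u l)) : ℂ)) * kern ν ς x (rotate φ u)

theorem continuous_rotate (φ : Fin d → ℝ) : Continuous (rotate φ) := by
  unfold rotate; fun_prop

theorem continuous_logPhase (ς : Fin (d + 1) → ℤˣ) : Continuous (logPhase ς) := by
  unfold logPhase; fun_prop

theorem continuous_kern (ν : Fin d → ℂ) (ς : Fin (d + 1) → ℤˣ) (x : ℝ) :
    Continuous (kern ν ς x) := by
  have := continuous_logPhase ς
  unfold kern; fun_prop

/-- The arguments `φ` are damping of strength `b`. -/
def Damping (ς : Fin (d + 1) → ℤˣ) (φ : Fin d → ℝ) (b : ℝ) : Prop :=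
  b ≤ ((ς (Fin.last d) : ℤ) : ℝ) * Real.sin (∑ l, φ l) ∧
    ∀ l, b ≤ -(((ς l.castSucc : ℤ) : ℝ) * Real.sin (φ l))

theorem sum_rotate (φ u : Fin d → ℝ) :
    ∑ l, rotate φ u l = ((∑ l, u l : ℝ) : ℂ) + ((∑ l, φ l : ℝ) : ℂ) * Complex.I := by
  simp [rotate, Finset.sum_add_distrib, Finset.sum_mul]

theorem norm_exp_sum_rotate (φ u : Fin d → ℝ) :
    ‖Complex.exp (∑ l, rotate φ u l)‖ = Real.exp (∑ l, u l) := by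
  rw [sum_rotate, Complex.norm_exp]; simp [-Complex.ofReal_sum]

theorem norm_exp_neg_rotate (φ u : Fin d → ℝ) (l : Fin d) :
    ‖Complex.exp (-rotate φ u l)‖ = Real.exp (-u l) := by
  rw [Complex.norm_exp]; simp [rotate]

theorem norm_unit_cast (e : ℤˣ) : ‖((e : ℤ) : ℂ)‖ = 1 := by
  rcases Int.units_eq_one_or e with h | h <;> simp [h]

theorem norm_sgn (ς : Fin (d + 1) → ℤˣ) (l : Fin d) : ‖sgn ς l‖ = 1 := norm_unit_cast _

theorem norm_sgnLast (ς : Fin (d + 1) → ℤˣ) : ‖sgnLast ς‖ = 1 := norm_unit_cast _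

theorem sgn_mul_self (ς : Fin (d + 1) → ℤˣ) (l : Fin d) : sgn ς l * sgn ς l = 1 := by
  unfold sgn
  rcases Int.units_eq_one_or (ς l.castSucc) with h | h <;> simp [h]

theorem sgnLast_mul_self (ς : Fin (d + 1) → ℤˣ) : sgnLast ς * sgnLast ς = 1 := by
  unfold sgnLast
  rcases Int.units_eq_one_or (ς (Fin.last d)) with h | h <;> simp [h]

theorem norm_logPhase_le (ς : Fin (d + 1) → ℤˣ) (φ u : Fin d → ℝ) :
    ‖logPhase ς (rotate φ u)‖ ≤ spread u := by
  unfold logPhase spread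
  refine (norm_add_le _ _).trans (add_le_add ?_ ((norm_sum_le _ _).trans
    (Finset.sum_le_sum fun l _ => ?_)))
  · rw [norm_mul, norm_sgnLast, norm_exp_sum_rotate, one_mul]
  · rw [norm_mul, norm_sgn, norm_exp_neg_rotate, one_mul]

theorem im_logPhase (ς : Fin (d + 1) → ℤˣ) (φ u : Fin d → ℝ) :
    (logPhase ς (rotate φ u)).im =
      ((ς (Fin.last d) : ℤ) : ℝ) * Real.sin (∑ l, φ l) * Real.exp (∑ l, u l) +
        ∑ l, -(((ς l.castSucc : ℤ) : ℝ) * Real.sin (φ l)) * Real.exp (-u l) := by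
  unfold logPhase
  rw [sum_rotate, Complex.add_im, Complex.im_sum]
  congr 1
  · rw [sgnLast, ← Complex.ofReal_intCast, Complex.im_ofReal_mul, Complex.exp_im]
    simp [-Complex.ofReal_sum]; ring
  · refine Finset.sum_congr rfl fun l _ => ?_
    rw [sgn, ← Complex.ofReal_intCast, Complex.im_ofReal_mul, Complex.exp_im]
    simp [rotate]; ring

theorem Damping.le_im_logPhase {ς : Fin (d + 1) → ℤˣ} {φ : Fin d → ℝ} {b : ℝ}
    (h : Damping ς φ b) (u : Fin d → ℝ) : b * spread u ≤ (logPhase ς (rotate φ u)).im := by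
  rw [im_logPhase, spread, mul_add, Finset.mul_sum]
  exact add_le_add (mul_le_mul_of_nonneg_right h.1 (Real.exp_pos _).le)
    (Finset.sum_le_sum fun l _ => mul_le_mul_of_nonneg_right (h.2 l) (Real.exp_pos _).le)

theorem norm_kern (ν : Fin d → ℂ) (ς : Fin (d + 1) → ℤˣ) (x : ℝ) (φ u : Fin d → ℝ) :
    ‖kern ν ς x (rotate φ u)‖ = Real.exp (∑ l, (ν l).re * u l - ∑ l, (ν l).im * φ l -
      x * (logPhase ς (rotate φ u)).im) := by
  rw [kern, Complex.norm_exp]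
  congr 1
  have : Complex.I * x * logPhase ς (rotate φ u) = x * (Complex.I * logPhase ς (rotate φ u)) := by
    ring
  rw [this, Complex.add_re, Complex.re_sum, Complex.re_ofReal_mul]
  simp [rotate, Finset.sum_sub_distrib]
  ring

/-- The factor with `Im ν_l φ_l` is the price of rotation, and the reason why the angles must
finally be of size `1/𝔠`. Strength `b = 0` is allowed, for the limit of vanishing angles. -/
theorem Damping.norm_kern_le {ς : Fin (d + 1) → ℤˣ} {φ : Fin d → ℝ} {b : ℝ}
    (h : Damping ς φ b) (ν : Fin d → ℂ) {x : ℝ} (hx : 0 ≤ x) (u : Fin d → ℝ) :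
    ‖kern ν ς x (rotate φ u)‖ ≤
      Real.exp (∑ l, |(ν l).im * φ l|) *
        (Real.exp (∑ l, (ν l).re * u l) * Real.exp (-(x * b * spread u))) := by
  rw [norm_kern, ← Real.exp_add, ← Real.exp_add, Real.exp_le_exp]
  have h1 := mul_le_mul_of_nonneg_left (h.le_im_logPhase u) hx
  have h2 : -∑ l, (ν l).im * φ l ≤ ∑ l, |(ν l).im * φ l| := by
    rw [← Finset.sum_neg_distrib]
    exact Finset.sum_le_sum fun l _ => neg_le_abs _
  linarith

theorem Damping.norm_kern_le_weight {ς : Fin (d + 1) → ℤˣ} {φ : Fin d → ℝ} {b : ℝ}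
    (h : Damping ς φ b) (ν : Fin d → ℂ) {x : ℝ} (hx : 0 ≤ x) {r : ℝ} (hr : ∀ l, |(ν l).re| ≤ r)
    (u : Fin d → ℝ) :
    ‖kern ν ς x (rotate φ u)‖ ≤ Real.exp (∑ l, |(ν l).im * φ l|) * weight r 0 (x * b) u := by
  refine (h.norm_kern_le ν hx u).trans ?_
  unfold weight
  rw [pow_zero, mul_one]
  gcongr
  rw [Finset.mul_sum]
  refine Finset.sum_le_sum fun l _ => (le_abs_self _).trans ?_
  rw [abs_mul]
  exact mul_le_mul_of_nonneg_right (hr l) (abs_nonneg _)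

/-! ### Weight functions under `t ∂` -/

theorem MemT.exists_bound {h : ℝ → ℝ} (hh : MemT h) :
    ∃ B : ℝ, 0 ≤ B ∧ ∀ t : ℝ, 0 < t → |h t| ≤ B := by
  obtain ⟨B, hB⟩ := hh.2 0
  refine ⟨B, (abs_nonneg _).trans (hB 1 one_pos), fun t ht => ?_⟩
  simpa using hB t ht

theorem MemT.differentiableAt_iteratedDeriv {h : ℝ → ℝ} (hh : MemT h) (n : ℕ) {t : ℝ}
    (ht : 0 < t) : DifferentiableAt ℝ (iteratedDeriv n h) t := by
  have h1 : DifferentiableOn ℝ (iteratedDerivWithin n h (Ioi 0)) (Ioi 0) :=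
    hh.1.differentiableOn_iteratedDerivWithin (by exact_mod_cast WithTop.coe_lt_top n)
      isOpen_Ioi.uniqueDiffOn
  have h2 := h1.differentiableAt (Ioi_mem_nhds ht)
  refine h2.congr_of_eventuallyEq ?_
  filter_upwards [Ioi_mem_nhds ht] with s hs
  exact (iteratedDerivWithin_of_isOpen isOpen_Ioi hs).symm

theorem MemT.differentiableAt {h : ℝ → ℝ} (hh : MemT h) {t : ℝ} (ht : 0 < t) :
    DifferentiableAt ℝ h t := by
  simpa using hh.differentiableAt_iteratedDeriv 0 ht

theorem MemT.continuous_comp_exp {h : ℝ → ℝ} (hh : MemT h) :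
    Continuous fun u : ℝ => h (Real.exp u) :=
  hh.1.continuousOn.comp_continuous Real.continuous_exp fun u => Real.exp_pos u

/-- Leibniz rule; two terms suffice because the second derivative of `t` vanishes. -/
theorem MemT.iteratedDeriv_eulerOp {h : ℝ → ℝ} (hh : MemT h) (n : ℕ) :
    ∀ t : ℝ, 0 < t → iteratedDeriv n (eulerOp h) t =
      t * iteratedDeriv (n + 1) h t + n * iteratedDeriv n h t := by
  induction n with
  | zero => intro t _; simp [eulerOp, iteratedDeriv_one]
  | succ n ih =>
    intro t ht
    have he : iteratedDeriv n (eulerOp h) =ᶠ[𝓝 t]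
        fun t => t * iteratedDeriv (n + 1) h t + n * iteratedDeriv n h t := by
      filter_upwards [Ioi_mem_nhds ht] with s hs using ih s hs
    rw [iteratedDeriv_succ, he.deriv_eq]
    have h1 := (hh.differentiableAt_iteratedDeriv (n + 1) ht).hasDerivAt
    have h2 := (hh.differentiableAt_iteratedDeriv n ht).hasDerivAt
    rw [← iteratedDeriv_succ] at h1 h2
    refine (((hasDerivAt_id t).mul h1).add (h2.const_mul (n : ℝ))).deriv.trans ?_
    simp
    ring

theorem MemT.eulerOp {h : ℝ → ℝ} (hh : MemT h) : MemT (eulerOp h) := by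
  refine ⟨contDiffOn_id.mul (hh.1.deriv_of_isOpen isOpen_Ioi (by simp)), fun α => ?_⟩
  obtain ⟨B₁, h₁⟩ := hh.2 (α + 1)
  obtain ⟨B₂, h₂⟩ := hh.2 α
  refine ⟨B₁ + α * B₂, fun t ht => ?_⟩
  rw [hh.iteratedDeriv_eulerOp α t ht]
  calc _ = |t ^ (α + 1) * iteratedDeriv (α + 1) h t + α * (t ^ α * iteratedDeriv α h t)| := by
        congr 1; ring
    _ ≤ _ := by
        refine (abs_add_le _ _).trans (add_le_add (h₁ t ht) ?_)
        rw [abs_mul, Nat.abs_cast]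
        exact mul_le_mul_of_nonneg_left (h₂ t ht) (Nat.cast_nonneg _)

theorem memT_one : MemT fun _ => 1 :=
  memT_of_eventually_const contDiff_const (c := 1) fun _ _ => rfl

theorem memT_update {h : Fin d → ℝ → ℝ} (hh : ∀ l, MemT (h l)) (l : Fin d) (j : Fin d) :
    MemT (Function.update h l (eulerOp (h l)) j) := by
  by_cases hj : j = l
  · subst hj; simpa using (hh j).eulerOp
  · simpa [hj] using hh j

/-- The product weight in logarithmic coordinates. -/
def logWeight (h : Fin d → ℝ → ℝ) (u : Fin d → ℝ) : ℂ := ∏ l, (h l (Real.exp (u l)) : ℂ)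

theorem continuous_logWeight {h : Fin d → ℝ → ℝ} (hh : ∀ l, MemT (h l)) :
    Continuous (logWeight h) := by
  unfold logWeight
  exact continuous_finsetProd _ fun l _ =>
    Complex.continuous_ofReal.comp ((hh l).continuous_comp_exp.comp (continuous_apply l))

theorem exists_norm_logWeight_le {h : Fin d → ℝ → ℝ} (hh : ∀ l, MemT (h l)) :
    ∃ B : ℝ, ∀ u, ‖logWeight h u‖ ≤ B := by
  choose B hB0 hB using fun l => (hh l).exists_bound
  refine ⟨∏ l, B l, fun u => ?_⟩
  rw [logWeight, norm_prod]
  refine Finset.prod_le_prod (fun _ _ => norm_nonneg _) fun l _ => ?_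
  simpa using hB l _ (Real.exp_pos (u l))

theorem exists_re_bound (ν : Fin d → ℂ) : ∃ r : ℝ, ∀ l, |(ν l).re| ≤ r :=
  ⟨∑ l, |(ν l).re|, fun l => Finset.single_le_sum (f := fun l => |(ν l).re|)
    (fun _ _ => abs_nonneg _) (Finset.mem_univ l)⟩

theorem integrable_rotJ {ς : Fin (d + 1) → ℤˣ} {φ : Fin d → ℝ} {b : ℝ} (hφ : Damping ς φ b)
    (hb : 0 < b) (ν : Fin d → ℂ) {x : ℝ} (hx : 0 < x) {h : Fin d → ℝ → ℝ} (hh : ∀ l, MemT (h l)) :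
    Integrable fun u => logWeight h u * kern ν ς x (rotate φ u) := by
  obtain ⟨B, hB⟩ := exists_norm_logWeight_le hh
  obtain ⟨r, hr⟩ := exists_re_bound ν
  refine Integrable.bdd_mul (c := B) ?_ (continuous_logWeight hh).aestronglyMeasurable
    (ae_of_all _ hB)
  refine Integrable.mono' (((integrable_weight r 0 (mul_pos hx hb)).const_mul
    (Real.exp (∑ l, |(ν l).im * φ l|))))
    ((continuous_kern ν ς x).comp (continuous_rotate φ)).aestronglyMeasurable
    (ae_of_all _ fun u => hφ.norm_kern_le_weight ν hx.le hr u)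

/-! ### Partial integration on a damping ray -/

/-- The logarithmic derivative of `kern` in the `l`-th coordinate. -/
def kernLogDeriv (ν : Fin d → ℂ) (ς : Fin (d + 1) → ℤˣ) (x : ℝ) (v : Fin d → ℂ) (l : Fin d) : ℂ :=
  ν l + Complex.I * x * (sgnLast ς * Complex.exp (∑ l, v l) - sgn ς l * Complex.exp (-v l))

/-- A general curve `v` serves two purposes: real translations for partial integration, and
imaginary ones for changing the angles. -/
theorem hasDerivAt_kern (ν : Fin d → ℂ) (ς : Fin (d + 1) → ℤˣ) (x : ℝ) {v : ℝ → Fin d → ℂ}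
    {v' : Fin d → ℂ} {s : ℝ} (hv : ∀ l, HasDerivAt (fun s => v s l) (v' l) s) :
    HasDerivAt (fun s => kern ν ς x (v s))
      (kern ν ς x (v s) * ∑ l, v' l * kernLogDeriv ν ς x (v s) l) s := by
  have h1 : HasDerivAt (fun s => ∑ l, ν l * v s l) (∑ l, ν l * v' l) s :=
    HasDerivAt.fun_sum fun l _ => (hv l).const_mul _
  have h2 : HasDerivAt (fun s => ∑ l, v s l) (∑ l, v' l) s := HasDerivAt.fun_sum fun l _ => hv l
  have h3 : HasDerivAt (fun s => ∑ l, sgn ς l * Complex.exp (-v s l))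
      (∑ l, sgn ς l * (Complex.exp (-v s l) * -v' l)) s :=
    HasDerivAt.fun_sum fun l _ => ((hv l).fun_neg.cexp).const_mul _
  have h4 := (h1.add (((h2.cexp.const_mul (sgnLast ς)).add h3).const_mul
    (Complex.I * (x : ℂ)))).cexp
  refine h4.congr_deriv ?_
  have : ∑ l, v' l * kernLogDeriv ν ς x (v s) l = ∑ l, ν l * v' l + Complex.I * x *
      (sgnLast ς * (Complex.exp (∑ l, v s l) * ∑ l, v' l) +
        ∑ l, sgn ς l * (Complex.exp (-v s l) * -v' l)) := by
    simp only [Finset.mul_sum, ← Finset.sum_add_distrib]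
    refine Finset.sum_congr rfl fun l _ => ?_
    unfold kernLogDeriv
    ring
  rw [this]
  rfl

theorem kern_add_one {ν ν' : Fin d → ℂ} (hν : ∀ l, ν' l = ν l + 1) (ς : Fin (d + 1) → ℤˣ)
    (x : ℝ) (v : Fin d → ℂ) : kern ν' ς x v = Complex.exp (∑ l, v l) * kern ν ς x v := by
  rw [kern, kern, ← Complex.exp_add, ← add_assoc, ← Finset.sum_add_distrib]
  simp only [hν]
  congr 3 with l
  ring

theorem kern_sub_single {ν ν' : Fin d → ℂ} {l : Fin d}
    (hν : ∀ j, ν' j = ν j - if j = l then 1 else 0) (ς : Fin (d + 1) → ℤˣ)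
    (x : ℝ) (v : Fin d → ℂ) : kern ν' ς x v = Complex.exp (-v l) * kern ν ς x v := by
  rw [kern, kern, ← Complex.exp_add, ← add_assoc]
  simp only [hν, sub_mul, Finset.sum_sub_distrib, ite_mul, one_mul, zero_mul,
    Finset.sum_ite_eq', Finset.mem_univ, if_true]
  ring_nf

/-- Multiplication by `t_1 ⋯ t_d` or `t_l⁻¹` only shifts the index, so differentiation stays within
the family of kernels. -/
theorem kern_mul_kernLogDeriv {ν νp νm : Fin d → ℂ} {l : Fin d} (hp : ∀ j, νp j = ν j + 1)
    (hm : ∀ j, νm j = ν j - if j = l then 1 else 0) (ς : Fin (d + 1) → ℤˣ) (x : ℝ)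
    (v : Fin d → ℂ) :
    kern ν ς x v * kernLogDeriv ν ς x v l = ν l * kern ν ς x v +
      Complex.I * x * sgnLast ς * kern νp ς x v - Complex.I * x * sgn ς l * kern νm ς x v := by
  rw [kern_add_one hp, kern_sub_single hm, kernLogDeriv]
  ring

/-- In logarithmic coordinates `∂/∂u_l` is `t_l ∂_l`. -/
theorem hasDerivAt_logWeight {h : Fin d → ℝ → ℝ} (hh : ∀ l, MemT (h l)) (l : Fin d)
    (u : Fin d → ℝ) :
    HasDerivAt (fun s : ℝ => logWeight h (u + s • Pi.single l 1))
      (logWeight (Function.update h l (eulerOp (h l))) u) 0 := by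
  have e1 : (fun s : ℝ => logWeight h (u + s • Pi.single l 1)) = fun s =>
      (h l (Real.exp (u l + s)) : ℂ) * ∏ j ∈ Finset.univ.erase l, (h j (Real.exp (u j)) : ℂ) := by
    funext s
    rw [logWeight, ← Finset.mul_prod_erase _ _ (Finset.mem_univ l)]
    congr 1
    · simp
    · refine Finset.prod_congr rfl fun j hj => ?_
      simp [Finset.ne_of_mem_erase hj]
  have e2 : logWeight (Function.update h l (eulerOp (h l))) u =
      (eulerOp (h l) (Real.exp (u l)) : ℂ) *
        ∏ j ∈ Finset.univ.erase l, (h j (Real.exp (u j)) : ℂ) := by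
    rw [logWeight, ← Finset.mul_prod_erase _ _ (Finset.mem_univ l)]
    congr 1
    · simp
    · refine Finset.prod_congr rfl fun j hj => ?_
      simp [Finset.ne_of_mem_erase hj]
  rw [e1, e2]
  refine HasDerivAt.mul_const (HasDerivAt.ofReal_comp ?_) _
  have h1 : HasDerivAt (fun s : ℝ => Real.exp (u l + s)) (Real.exp (u l)) 0 := by
    simpa using ((hasDerivAt_id (0 : ℝ)).const_add (u l)).exp
  have h2 : HasDerivAt (h l) (deriv (h l) (Real.exp (u l))) (Real.exp (u l + 0)) := by
    rw [add_zero]; exact ((hh l).differentiableAt (Real.exp_pos _)).hasDerivAt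
  refine (h2.comp (0 : ℝ) h1).congr_deriv ?_
  rw [eulerOp, mul_comm]

/-- Integration by parts against the constant `1`; integrability replaces boundary terms. -/
theorem integral_eq_zero_of_hasLineDerivAt {f f' : (Fin d → ℝ) → ℂ} {v : Fin d → ℝ}
    (hf : Integrable f) (hf' : Integrable f') (h : ∀ u, HasLineDerivAt ℝ f (f' u) u v) :
    ∫ u, f' u = 0 := by
  have := integral_bilinear_hasLineDerivAt_right_eq_neg_left_of_integrable (μ := volume)
    (f := fun _ : Fin d → ℝ => (1 : ℂ)) (f' := fun _ => 0) (g := f) (g' := f') (v := v)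
    (B := ContinuousLinearMap.mul ℝ ℂ) (by simp) (by simpa using hf') (by simpa using hf)
    (fun u _ => hasDerivAt_const (0 : ℝ) (1 : ℂ)) (fun u _ => h u)
  simpa using this

theorem rotJ_eq (ν : Fin d → ℂ) (ς : Fin (d + 1) → ℤˣ) (φ : Fin d → ℝ) (h : Fin d → ℝ → ℝ)
    (x : ℝ) : rotJ ν ς φ h x = ∫ u, logWeight h u * kern ν ς x (rotate φ u) := rfl

/-- Partial integration in the `l`-th variable. -/
theorem rotJ_partial_integration {ς : Fin (d + 1) → ℤˣ} {φ : Fin d → ℝ} {b : ℝ}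
    (hφ : Damping ς φ b) (hb : 0 < b) {ν νp νm : Fin d → ℂ} {l : Fin d}
    (hp : ∀ j, νp j = ν j + 1) (hm : ∀ j, νm j = ν j - if j = l then 1 else 0)
    {x : ℝ} (hx : 0 < x) {h : Fin d → ℝ → ℝ} (hh : ∀ l, MemT (h l)) :
    rotJ ν ς φ (Function.update h l (eulerOp (h l))) x + ν l * rotJ ν ς φ h x +
      Complex.I * x * sgnLast ς * rotJ νp ς φ h x - Complex.I * x * sgn ς l * rotJ νm ς φ h x
      = 0 := by
  have i0 := integrable_rotJ hφ hb ν hx (memT_update hh l)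
  have i1 := integrable_rotJ hφ hb ν hx hh
  have i2 := integrable_rotJ hφ hb νp hx hh
  have i3 := integrable_rotJ hφ hb νm hx hh
  simp only [rotJ_eq]
  rw [← integral_const_mul, ← integral_const_mul, ← integral_const_mul,
    ← integral_add i0 (i1.const_mul _), ← integral_add (i0.fun_add (i1.const_mul _)) (i2.const_mul _),
    ← integral_sub ((i0.fun_add (i1.const_mul _)).fun_add (i2.const_mul _)) (i3.const_mul _)]
  refine integral_eq_zero_of_hasLineDerivAt (v := Pi.single l 1) i1
    (((i0.fun_add (i1.const_mul _)).fun_add (i2.const_mul _)).sub (i3.const_mul _)) fun u => ?_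
  have hv : ∀ j, HasDerivAt (fun s : ℝ => rotate φ (u + s • Pi.single l 1) j)
      ((Pi.single l 1 : Fin d → ℂ) j) 0 := by
    intro j
    unfold rotate
    refine HasDerivAt.add_const _ ?_
    have : HasDerivAt (fun s : ℝ => (u + s • (Pi.single l 1 : Fin d → ℝ)) j)
        ((Pi.single l 1 : Fin d → ℝ) j) 0 := by
      simpa using ((hasDerivAt_id (0 : ℝ)).mul_const ((Pi.single l 1 : Fin d → ℝ) j)).const_add (u j)
    refine this.ofReal_comp.congr_deriv ?_
    by_cases hj : j = l
    · subst hj; simp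
    · simp [hj]
  have h1 := (hasDerivAt_logWeight hh l u).mul (hasDerivAt_kern ν ς x hv)
  refine HasDerivAt.congr_deriv h1 ?_
  simp only [zero_smul, add_zero]
  have : ∑ j, (Pi.single l 1 : Fin d → ℂ) j * kernLogDeriv ν ς x (rotate φ u) j =
      kernLogDeriv ν ς x (rotate φ u) l := by
    rw [Finset.sum_eq_single l] <;> simp +contextual
  rw [this, kern_mul_kernLogDeriv hp hm]
  ring

/-! ### Formal operators as identities on damping rays -/

/-- The value of a term with its `J`-integral taken over the rays of arguments `φ`. -/
def JTerm.rotEval (ν : Fin d → ℂ) (ς : Fin (d + 1) → ℤˣ) (φ : Fin d → ℝ) (x : ℝ) (T : JTerm d) :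
    ℂ :=
  T.coeff * ((x : ℂ)⁻¹) ^ T.deg * rotJ (fun l => ν l + (T.shift l : ℂ)) ς φ T.h x

/-- One linear solution covers both kinds of operator, since the second arises from the first by
exchanging the two signs and negating them. -/
theorem solve_partial_integration {s s' x n W X Y Z : ℂ} (hs : s * s = 1) (hx : x ≠ 0)
    (h : W + n * Y + Complex.I * x * s' * Z - Complex.I * x * s * X = 0) :
    X = s * s' * Z - s * Complex.I * n * x⁻¹ * Y - s * Complex.I * x⁻¹ * W := by
  have h1 : x * x⁻¹ = 1 := mul_inv_cancel₀ hx
  have h2 : Complex.I * Complex.I = -1 := Complex.I_mul_I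
  linear_combination Complex.I * s * x⁻¹ * h + (-s * s' * Z) * (x * x⁻¹ * h2 - h1) +
    X * (s * s * (x * x⁻¹) * h2 - s * s * h1 - hs)

theorem sum_rotEval_opPlus {ς : Fin (d + 1) → ℤˣ} {φ : Fin d → ℝ} {b : ℝ} (hφ : Damping ς φ b)
    (hb : 0 < b) (ν : Fin d → ℂ) {x : ℝ} (hx : 0 < x) (l : Fin d) {T : JTerm d}
    (hT : ∀ l, MemT (T.h l)) :
    ((opPlus ν ς l T).map (JTerm.rotEval ν ς φ x)).sum = T.rotEval ν ς φ x := by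
  -- The base index is raised by `e_l`, so that the `t_l⁻¹` term carries the original index and can
  -- be solved for.
  have hI := rotJ_partial_integration hφ hb (l := l)
    (ν := fun j => ν j + ((T.shift + Pi.single l 1 : Fin d → ℤ) j : ℂ))
    (νp := fun j => ν j + ((T.shift + 1 + Pi.single l 1 : Fin d → ℤ) j : ℂ))
    (νm := fun j => ν j + (T.shift j : ℂ)) (fun j => by simp; ring)
    (fun j => by by_cases hj : j = l <;> simp [hj]; ring) hx hT
  beta_reduce at hI
  rw [show ν l + ((T.shift + Pi.single l 1 : Fin d → ℤ) l : ℂ) = ν l + T.shift l + 1 by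
    simp; ring] at hI
  have hX := solve_partial_integration (sgn_mul_self ς l)
    (show (x : ℂ) ≠ 0 by exact_mod_cast hx.ne') hI
  simp only [opPlus, List.map_cons, List.map_nil, List.sum_cons, List.sum_nil, JTerm.rotEval]
  rw [hX]
  ring

theorem sum_rotEval_opMinus {ς : Fin (d + 1) → ℤˣ} {φ : Fin d → ℝ} {b : ℝ} (hφ : Damping ς φ b)
    (hb : 0 < b) (ν : Fin d → ℂ) {x : ℝ} (hx : 0 < x) (l : Fin d) {T : JTerm d}
    (hT : ∀ l, MemT (T.h l)) :
    ((opMinus ν ς l T).map (JTerm.rotEval ν ς φ x)).sum = T.rotEval ν ς φ x := by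
  -- Here the base index is lowered by `e^d`, so that the original index sits on the `t_1 ⋯ t_d`
  -- term.
  have hI := rotJ_partial_integration hφ hb (l := l)
    (ν := fun j => ν j + ((T.shift - 1 : Fin d → ℤ) j : ℂ))
    (νp := fun j => ν j + (T.shift j : ℂ))
    (νm := fun j => ν j + ((T.shift - 1 - Pi.single l 1 : Fin d → ℤ) j : ℂ))
    (fun j => by simp; ring)
    (fun j => by by_cases hj : j = l <;> simp [hj]; ring) hx hT
  beta_reduce at hI
  rw [show ν l + ((T.shift - 1 : Fin d → ℤ) l : ℂ) = ν l + T.shift l - 1 by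
    simp; ring] at hI
  have hI' := fun A X Z (h : A + Complex.I * x * sgnLast ς * X - Complex.I * x * sgn ς l * Z = 0) =>
    show A + Complex.I * x * (-sgn ς l) * Z - Complex.I * x * (-sgnLast ς) * X = 0 by
      rw [← h]; ring
  have hX := solve_partial_integration (by rw [neg_mul_neg, sgnLast_mul_self])
    (show (x : ℂ) ≠ 0 by exact_mod_cast hx.ne') (hI' _ _ _ hI)
  simp only [opMinus, List.map_cons, List.map_nil, List.sum_cons, List.sum_nil, JTerm.rotEval]
  rw [hX]
  ring

/-- `P l f` for the `l`-th weight function of the term, for all `l`. -/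
def JTerm.Weights (P : Fin d → (ℝ → ℝ) → Prop) (T : JTerm d) : Prop := ∀ l, P l (T.h l)

/-- The predicates `P l` are preserved by `t ∂`. -/
def EulerStable (P : Fin d → (ℝ → ℝ) → Prop) : Prop := ∀ l f, P l f → P l (eulerOp f)

theorem EulerStable.update {P : Fin d → (ℝ → ℝ) → Prop} (hP : EulerStable P)
    {h : Fin d → ℝ → ℝ} (hh : ∀ l, P l (h l)) (l j : Fin d) :
    P j (Function.update h l (eulerOp (h l)) j) := by
  by_cases hj : j = l
  · subst hj; simpa using hP _ _ (hh j)
  · simpa [hj] using hh j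

theorem EulerStable.opPlus {P : Fin d → (ℝ → ℝ) → Prop} (hP : EulerStable P) {ν : Fin d → ℂ}
    {ς : Fin (d + 1) → ℤˣ} {l : Fin d} (T : JTerm d) (hT : T.Weights P) :
    ∀ T' ∈ opPlus ν ς l T, T'.Weights P := by
  simp only [FundamentalBessel.opPlus, List.mem_cons, List.not_mem_nil, or_false, forall_eq_or_imp,
    forall_eq]
  exact ⟨hT, hT, hP.update hT l⟩

theorem EulerStable.opMinus {P : Fin d → (ℝ → ℝ) → Prop} (hP : EulerStable P) {ν : Fin d → ℂ}
    {ς : Fin (d + 1) → ℤˣ} {l : Fin d} (T : JTerm d) (hT : T.Weights P) :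
    ∀ T' ∈ opMinus ν ς l T, T'.Weights P := by
  simp only [FundamentalBessel.opMinus, List.mem_cons, List.not_mem_nil, or_false,
    forall_eq_or_imp, forall_eq]
  exact ⟨hT, hT, hP.update hT l⟩

theorem opPow_succ (op : JTerm d → List (JTerm d)) (n : ℕ) (S : List (JTerm d)) :
    opPow op (n + 1) S = opPow op n (S.flatMap op) := rfl

/-- The invariant may depend on the number of steps, as needed for tracking index shifts. -/
theorem forall_mem_opPow {op : JTerm d → List (JTerm d)} {P : ℕ → JTerm d → Prop}
    (h : ∀ n T, P n T → ∀ T' ∈ op T, P (n + 1) T') (n : ℕ) :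
    ∀ (k : ℕ) (S : List (JTerm d)), (∀ T ∈ S, P k T) → ∀ T ∈ opPow op n S, P (k + n) T := by
  induction n with
  | zero => exact fun k S hS => hS
  | succ n ih =>
    intro k S hS
    rw [opPow_succ, show k + (n + 1) = k + 1 + n by ring]
    refine ih (k + 1) _ fun T hT => ?_
    obtain ⟨T₀, h₀, h₁⟩ := List.mem_flatMap.1 hT
    exact h k T₀ (hS T₀ h₀) T h₁

theorem sum_map_flatMap {op : JTerm d → List (JTerm d)} {f : JTerm d → ℂ} (S : List (JTerm d))
    (h : ∀ T ∈ S, ((op T).map f).sum = f T) : ((S.flatMap op).map f).sum = (S.map f).sum := by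
  induction S with
  | nil => rfl
  | cons T S ih =>
    rw [List.flatMap_cons, List.map_append, List.sum_append, List.map_cons, List.sum_cons,
      h T List.mem_cons_self, ih fun T hT => h T (List.mem_cons_of_mem _ hT)]

theorem sum_map_opPow {op : JTerm d → List (JTerm d)} {P : JTerm d → Prop} {f : JTerm d → ℂ}
    (hP : ∀ T, P T → ∀ T' ∈ op T, P T') (hf : ∀ T, P T → ((op T).map f).sum = f T) (n : ℕ) :
    ∀ S : List (JTerm d), (∀ T ∈ S, P T) → ((opPow op n S).map f).sum = (S.map f).sum := by
  induction n with
  | zero => exact fun S hS => rfl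
  | succ n ih =>
    intro S hS
    rw [opPow_succ, ih, sum_map_flatMap S fun T hT => hf T (hS T hT)]
    intro T hT
    obtain ⟨T₀, h₀, h₁⟩ := List.mem_flatMap.1 hT
    exact hP T₀ (hS T₀ h₀) T h₁

theorem forall_mem_opPow_const {op : JTerm d → List (JTerm d)} {P : JTerm d → Prop}
    (hP : ∀ T, P T → ∀ T' ∈ op T, P T') (n : ℕ) {S : List (JTerm d)} (hS : ∀ T ∈ S, P T) :
    ∀ T ∈ opPow op n S, P T :=
  forall_mem_opPow (P := fun _ => P) (fun _ => hP) n 0 S hS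

theorem EulerStable.opPlusAll {P : Fin d → (ℝ → ℝ) → Prop} (hP : EulerStable P) {ν : Fin d → ℂ}
    {ς : Fin (d + 1) → ℤˣ} (n : ℕ) (L : List (Fin d)) : ∀ S : List (JTerm d),
    (∀ T ∈ S, T.Weights P) → ∀ T ∈ opPlusAll ν ς L n S, T.Weights P := by
  induction L with
  | nil => exact fun S hS => hS
  | cons l L ih => exact fun S hS => ih _ (forall_mem_opPow_const hP.opPlus n hS)

theorem eulerStable_memT : EulerStable (fun (_ : Fin d) f => MemT f) := fun _ _ hf => hf.eulerOp

theorem sum_rotEval_opPlusAll {ς : Fin (d + 1) → ℤˣ} {φ : Fin d → ℝ} {b : ℝ}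
    (hφ : Damping ς φ b) (hb : 0 < b) (ν : Fin d → ℂ) {x : ℝ} (hx : 0 < x) (n : ℕ)
    (L : List (Fin d)) : ∀ S : List (JTerm d), (∀ T ∈ S, T.Weights fun _ f => MemT f) →
    ((opPlusAll ν ς L n S).map (JTerm.rotEval ν ς φ x)).sum =
      (S.map (JTerm.rotEval ν ς φ x)).sum := by
  induction L with
  | nil => exact fun S hS => rfl
  | cons l L ih =>
    exact fun S hS => (ih _ (forall_mem_opPow_const eulerStable_memT.opPlus n hS)).trans
      (sum_map_opPow eulerStable_memT.opPlus
        (fun T hT => sum_rotEval_opPlus hφ hb ν hx l hT) n S hS)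

/-- Every formal partial integration preserves the integrals over damping rays. -/
theorem sum_rotEval_regularizedPiece {ς : Fin (d + 1) → ℤˣ} {φ : Fin d → ℝ} {b : ℝ}
    (hφ : Damping ς φ b) (hb : 0 < b) {ν : Fin d → ℂ} (R : RegularizationData ν) {x : ℝ}
    (hx : 0 < x) (ϱ : Fin d → R.ι) :
    ((regularizedPiece R ς ϱ).map (JTerm.rotEval ν ς φ x)).sum =
      rotJ ν ς φ (fun l => R.h (ϱ l)) x := by
  have h0 : ∀ T ∈ [({ coeff := 1, deg := 0, shift := 0, h := fun l => R.h (ϱ l) } : JTerm d)],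
      T.Weights fun _ f => MemT f := by
    simp [JTerm.Weights, R.memT]
  have h1 : ([({ coeff := 1, deg := 0, shift := 0, h := fun l => R.h (ϱ l) } : JTerm d)].map
      (JTerm.rotEval ν ς φ x)).sum = rotJ ν ς φ (fun l => R.h (ϱ l)) x := by
    simp [JTerm.rotEval]
  unfold regularizedPiece
  dsimp only
  split_ifs
  · rw [sum_map_flatMap, sum_rotEval_opPlusAll hφ hb ν hx _ _ _ h0, h1]
    intro T hT
    have hT' := eulerStable_memT.opPlusAll _ _ _ h0 T hT
    rw [sum_map_opPow eulerStable_memT.opMinus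
      (fun T hT => sum_rotEval_opMinus hφ hb ν hx _ hT) _ _ (by simpa using hT')]
    simp
  · rw [sum_rotEval_opPlusAll hφ hb ν hx _ _ _ h0, h1]

/-! ### Index shifts produced by the operators -/

/-- Each application of `𝒫_{+, l}` adds `e_l` in all three terms and `e^d` in only one. The unknown
number of `e^d` is `α`; `f` records the `e_l` already added. -/
theorem shift_opPlusAll {ν : Fin d → ℂ} {ς : Fin (d + 1) → ℤˣ} (n : ℕ) (L : List (Fin d)) :
    ∀ (f : Fin d → ℕ) (S : List (JTerm d)),
      (∀ T ∈ S, ∃ α : ℕ, ∀ j, T.shift j = α + f j) →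
      ∀ T ∈ opPlusAll ν ς L n S, ∃ α : ℕ, ∀ j, T.shift j = α + (f j + n * L.count j : ℕ) := by
  induction L with
  | nil => intro f S hS; simpa [opPlusAll] using hS
  | cons l L ih =>
    intro f S hS T hT
    have h1 := forall_mem_opPow (op := opPlus ν ς l)
      (P := fun m T => ∃ α : ℕ, ∀ j, T.shift j = α + (f j + m * if j = l then 1 else 0 : ℕ))
      (fun m T ⟨α, hα⟩ => by
        simp only [opPlus, List.mem_cons, List.not_mem_nil, or_false, forall_eq_or_imp, forall_eq]
        refine ⟨⟨α + 1, fun j => ?_⟩, ⟨α, fun j => ?_⟩, ⟨α, fun j => ?_⟩⟩ <;>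
        · by_cases hj : j = l
          · subst hj; simp [hα]; ring
          · simp [hα, hj]; try ring)
      n 0 S (by simpa using hS)
    obtain ⟨α, hα⟩ := ih _ _ h1 T hT
    refine ⟨α, fun j => ?_⟩
    rw [hα, List.count_cons]
    by_cases hj : j = l
    · subst hj; simp; ring
    · simp [hj, Ne.symm hj]

/-- Each application of `𝒫_{-, l}` subtracts `e^d` in all three terms and `e_l` in only one, hence
equality away from `l` but just an upper bound at `l`. -/
theorem shift_opPow_opMinus {ν : Fin d → ℂ} {ς : Fin (d + 1) → ℤˣ} (l : Fin d) (n : ℕ)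
    (T₀ : JTerm d) : ∀ T ∈ opPow (opMinus ν ς l) n [T₀],
      (∀ j, T.shift j ≤ T₀.shift j - n) ∧ ∀ j, j ≠ l → T.shift j = T₀.shift j - n := by
  have h1 := forall_mem_opPow (op := opMinus ν ς l)
      (P := fun m T => (∀ j, T.shift j ≤ T₀.shift j - m) ∧
        ∀ j, j ≠ l → T.shift j = T₀.shift j - m)
      (fun m T ⟨hT, hT'⟩ => by
        simp only [opMinus, List.mem_cons, List.not_mem_nil, or_false, forall_eq_or_imp, forall_eq]
        refine ⟨⟨fun j => ?_, fun j hj => ?_⟩, ⟨fun j => ?_, fun j hj => ?_⟩,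
          ⟨fun j => ?_, fun j hj => ?_⟩⟩
        · have := hT j
          by_cases hj : j = l
          · subst hj; simp; omega
          · simp [hj]; omega
        · have := hT' j hj
          simp [hj]; omega
        all_goals
          first
          | have := hT' j hj
            simp; omega
          | have := hT j
            simp; omega)
      n 0 [T₀] (by simp)
  simpa using h1

/-! ### Passage to logarithmic coordinates -/

theorem range_exp_comp :
    (fun (u : Fin d → ℝ) l => Real.exp (u l)) '' univ = Set.pi univ fun _ => Ioi (0 : ℝ) := by
  ext t
  simp only [image_univ, mem_range, Set.mem_pi, mem_univ, forall_const, mem_Ioi]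
  constructor
  · rintro ⟨u, rfl⟩ l
    exact Real.exp_pos _
  · exact fun ht => ⟨fun l => Real.log (t l), funext fun l => Real.exp_log (ht l)⟩

/-- Change to logarithmic coordinates. -/
theorem setIntegral_pi_Ioi_eq (F : (Fin d → ℝ) → ℂ) :
    ∫ t in Set.pi univ (fun _ : Fin d => Ioi (0 : ℝ)), F t =
      ∫ u : Fin d → ℝ, (∏ l, (Real.exp (u l) : ℂ)) * F fun l => Real.exp (u l) := by
  have hd : ∀ u ∈ (univ : Set (Fin d → ℝ)),
      HasFDerivWithinAt (fun (u : Fin d → ℝ) l => Real.exp (u l))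
        (ContinuousLinearMap.pi fun l => Real.exp (u l) •
          (ContinuousLinearMap.proj l : (Fin d → ℝ) →L[ℝ] ℝ)) univ u := by
    intro u _
    refine HasFDerivAt.hasFDerivWithinAt (hasFDerivAt_pi.2 fun l => ?_)
    exact (hasFDerivAt_apply l u).exp
  have hi : InjOn (fun (u : Fin d → ℝ) l => Real.exp (u l)) univ := by
    intro u _ v _ h
    exact funext fun l => Real.exp_injective (congrFun h l)
  rw [← range_exp_comp, integral_image_eq_integral_abs_det_fderiv_smul volume
    MeasurableSet.univ hd hi, setIntegral_univ]
  refine integral_congr_ae (ae_of_all _ fun u => ?_)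
  have hdet : (ContinuousLinearMap.pi fun l => Real.exp (u l) •
      (ContinuousLinearMap.proj l : (Fin d → ℝ) →L[ℝ] ℝ)).det = ∏ l, Real.exp (u l) := by
    have : ((ContinuousLinearMap.pi fun l => Real.exp (u l) •
        (ContinuousLinearMap.proj l : (Fin d → ℝ) →L[ℝ] ℝ) : (Fin d → ℝ) →L[ℝ] (Fin d → ℝ)) :
        (Fin d → ℝ) →ₗ[ℝ] (Fin d → ℝ)) = Matrix.toLin' (Matrix.diagonal fun l => Real.exp (u l)) := by
      ext i j
      simp [Matrix.mulVec_diagonal]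
    rw [ContinuousLinearMap.det, this, LinearMap.det_toLin', Matrix.det_diagonal]
  beta_reduce
  rw [hdet, abs_of_pos (Finset.prod_pos fun l _ => Real.exp_pos _), Complex.real_smul,
    Complex.ofReal_prod]

/-- The Jacobian `∏ e^{u_l}` turns the exponents `ν_l - 1` into `ν_l`, which is the kernel at angle
zero. -/
theorem JIntegral_eq_rotJ (ν : Fin d → ℂ) (ς : Fin (d + 1) → ℤˣ) (h : Fin d → ℝ → ℝ) (x : ℝ) :
    JIntegral ν ς h x = rotJ ν ς 0 h x := by
  rw [JIntegral, setIntegral_pi_Ioi_eq, rotJ]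
  refine integral_congr_ae (ae_of_all _ fun u => ?_)
  have hpow : ∀ l, (Real.exp (u l) : ℂ) * (Real.exp (u l) : ℂ) ^ (ν l - 1) =
      Complex.exp (ν l * u l) := by
    intro l
    have h0 : (Real.exp (u l) : ℂ) ≠ 0 := by exact_mod_cast (Real.exp_pos _).ne'
    rw [Complex.cpow_def_of_ne_zero h0, ← Complex.ofReal_log (Real.exp_pos _).le, Real.log_exp,
      Complex.ofReal_exp, ← Complex.exp_add]
    ring_nf
  have hphase : phase ς (fun l => Real.exp (u l)) = logPhase ς (rotate 0 u) := by
    simp [phase, logPhase, rotate, Complex.exp_sum, Complex.exp_neg]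
  have hp : (∏ l, (Real.exp (u l) : ℂ)) * powerFn ν (fun l => Real.exp (u l)) =
      Complex.exp (∑ l, ν l * rotate 0 u l) := by
    rw [powerFn, ← Finset.prod_mul_distrib, Complex.exp_sum]
    exact Finset.prod_congr rfl fun l _ => by rw [hpow]; simp [rotate]
  beta_reduce
  rw [kern, Complex.exp_add, ← hp, hphase]
  ring

/-! ### The limit of vanishing angles -/

/-- `f` vanishes near infinity. -/
def VanishTop (f : ℝ → ℝ) : Prop := ∃ K, 0 < K ∧ ∀ t, K < t → f t = 0

/-- `f` vanishes near zero from the right. -/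
def VanishZero (f : ℝ → ℝ) : Prop := ∃ K, 0 < K ∧ ∀ t, 0 < t → t < K → f t = 0

theorem eulerOp_eq_zero_of_eventually {f : ℝ → ℝ} {t : ℝ} (h : f =ᶠ[𝓝 t] fun _ => 0) :
    eulerOp f t = 0 := by
  rw [eulerOp, h.deriv_eq]; simp

theorem VanishTop.eulerOp {f : ℝ → ℝ} (hf : VanishTop f) : VanishTop (eulerOp f) := by
  obtain ⟨K, hK, h⟩ := hf
  refine ⟨K, hK, fun t ht => eulerOp_eq_zero_of_eventually ?_⟩
  filter_upwards [Ioi_mem_nhds ht] with s hs using h s hs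

theorem VanishZero.eulerOp {f : ℝ → ℝ} (hf : VanishZero f) : VanishZero (eulerOp f) := by
  obtain ⟨K, hK, h⟩ := hf
  refine ⟨K, hK, fun t ht ht' => eulerOp_eq_zero_of_eventually ?_⟩
  filter_upwards [Ioo_mem_nhds ht ht'] with s hs using h s hs.1 hs.2

theorem exists_mul_exp_le {g : ℝ → ℝ} {B : ℝ} (hB : ∀ u, |g u| ≤ B) {s : ℝ}
    (h : (∃ K, ∀ u, K < u → g u = 0) ∨ s ≤ -1) :
    ∃ C : ℝ, 0 ≤ C ∧ ∀ u, 0 ≤ u → |g u| * Real.exp (s * u) ≤ C * Real.exp (-u) := by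
  have hB0 : 0 ≤ B := (abs_nonneg _).trans (hB 0)
  rcases h with ⟨K, hK⟩ | hs
  · refine ⟨B * Real.exp (|s + 1| * |K|), by positivity, fun u hu => ?_⟩
    rcases lt_or_ge K u with h | h
    · rw [hK u h]; simp; positivity
    · rw [mul_assoc, ← Real.exp_add]
      refine mul_le_mul (hB u) (Real.exp_le_exp.2 ?_) (Real.exp_pos _).le hB0
      have : (s + 1) * u ≤ |s + 1| * |K| := mul_le_mul (le_abs_self _) (h.trans (le_abs_self K)) hu
        (abs_nonneg _)
      linarith
  · refine ⟨B, hB0, fun u hu => ?_⟩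
    refine mul_le_mul (hB u) (Real.exp_le_exp.2 ?_) (Real.exp_pos _).le hB0
    nlinarith

/-- Each end is handled separately, either by the cut-off or by the exponent; the end at zero is the
end at infinity after `u ↦ -u`. -/
theorem MemT.exists_mul_exp_le {f : ℝ → ℝ} (hf : MemT f) {s : ℝ} (h1 : VanishTop f ∨ s ≤ -1)
    (h2 : VanishZero f ∨ 1 ≤ s) :
    ∃ C : ℝ, 0 ≤ C ∧ ∀ u, |f (Real.exp u)| * Real.exp (s * u) ≤ C * Real.exp (-|u|) := by
  obtain ⟨B, -, hB⟩ := hf.exists_bound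
  obtain ⟨C₁, hC₁, h₁⟩ := FundamentalBessel.exists_mul_exp_le (g := fun u => f (Real.exp u))
    (fun u => hB _ (Real.exp_pos u)) (s := s) (h1.imp_left fun ⟨K, hK, h⟩ =>
      ⟨Real.log K, fun u hu => h _ ((Real.log_lt_iff_lt_exp hK).1 hu)⟩)
  obtain ⟨C₂, hC₂, h₂⟩ := FundamentalBessel.exists_mul_exp_le (g := fun u => f (Real.exp (-u)))
    (fun u => hB _ (Real.exp_pos (-u))) (s := -s) (h2.imp (fun ⟨K, hK, h⟩ =>
      ⟨-Real.log K, fun u hu => h _ (Real.exp_pos _)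
        ((Real.lt_log_iff_exp_lt hK).1 (by linarith))⟩) fun h => by linarith)
  refine ⟨max C₁ C₂, le_max_of_le_left hC₁, fun u => ?_⟩
  rcases le_total 0 u with hu | hu
  · rw [abs_of_nonneg hu]
    exact (h₁ u hu).trans (mul_le_mul_of_nonneg_right (le_max_left _ _) (Real.exp_pos _).le)
  · rw [abs_of_nonpos hu]
    have := h₂ (-u) (by linarith)
    rw [neg_neg, neg_mul_neg] at this
    rw [neg_neg]
    exact this.trans (mul_le_mul_of_nonneg_right (le_max_right _ _) (Real.exp_pos _).le)

/-- The integrals over damping rays tend to the absolutely convergent `J`-integral when the rays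
tend to the half-lines. -/
theorem tendsto_rotJ {ς : Fin (d + 1) → ℤˣ} {φ : Fin d → ℝ}
    (hφ : ∀ τ ∈ Ioo (0 : ℝ) 1, Damping ς (τ • φ) 0) (ν : Fin d → ℂ) {x : ℝ} (hx : 0 < x)
    {h : Fin d → ℝ → ℝ} (hh : ∀ l, MemT (h l)) (h1 : ∀ l, VanishTop (h l) ∨ (ν l).re ≤ -1)
    (h2 : ∀ l, VanishZero (h l) ∨ 1 ≤ (ν l).re) :
    Tendsto (fun τ : ℝ => rotJ ν ς (τ • φ) h x) (𝓝[>] 0) (𝓝 (JIntegral ν ς h x)) := by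
  choose C hC0 hC using fun l => (hh l).exists_mul_exp_le (h1 l) (h2 l)
  rw [JIntegral_eq_rotJ]
  simp only [rotJ_eq]
  -- The oscillating factor is bounded by `1` only, as its damping is not uniform as `τ → 0`.
  -- Integrability comes from the cut-offs and the shifted exponents.
  refine tendsto_integral_filter_of_dominated_convergence
    (fun u => Real.exp (∑ l, |(ν l).im * φ l|) * ((∏ l, C l) * ∏ l, Real.exp (-|u l|)))
    (Eventually.of_forall fun τ => ?_) ?_ ?_ (ae_of_all _ fun u => ?_)
  · exact ((continuous_logWeight hh).mul
      ((continuous_kern ν ς x).comp (continuous_rotate _))).aestronglyMeasurable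
  · filter_upwards [Ioo_mem_nhdsGT (zero_lt_one' ℝ)] with τ hτ
    refine ae_of_all _ fun u => ?_
    have hk := (hφ τ hτ).norm_kern_le ν hx.le u
    rw [mul_zero, zero_mul, neg_zero, Real.exp_zero, mul_one] at hk
    have hE : ∑ l, |(ν l).im * (τ • φ) l| ≤ ∑ l, |(ν l).im * φ l| := by
      refine Finset.sum_le_sum fun l _ => ?_
      rw [Pi.smul_apply, smul_eq_mul, mul_left_comm, abs_mul, abs_of_pos hτ.1]
      exact mul_le_of_le_one_left (abs_nonneg _) hτ.2.le
    rw [norm_mul]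
    calc ‖logWeight h u‖ * ‖kern ν ς x (rotate (τ • φ) u)‖
        ≤ ‖logWeight h u‖ * (Real.exp (∑ l, |(ν l).im * φ l|) *
            Real.exp (∑ l, (ν l).re * u l)) := by
          refine mul_le_mul_of_nonneg_left (hk.trans ?_) (norm_nonneg _)
          gcongr
      _ = Real.exp (∑ l, |(ν l).im * φ l|) *
            ∏ l, (|h l (Real.exp (u l))| * Real.exp ((ν l).re * u l)) := by
          rw [logWeight, norm_prod, Finset.prod_mul_distrib,
            Real.exp_sum Finset.univ fun l => (ν l).re * u l]
          simp only [Complex.norm_real, Real.norm_eq_abs]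
          ring
      _ ≤ _ := by
          rw [← Finset.prod_mul_distrib]
          refine mul_le_mul_of_nonneg_left (Finset.prod_le_prod (fun l _ => by positivity)
            fun l _ => hC l _) (Real.exp_pos _).le
  · exact (integrable_prod_exp_neg_abs.const_mul _).const_mul _
  · refine (Tendsto.const_mul _ ?_)
    have hc : Continuous fun τ : ℝ => kern ν ς x (rotate (τ • φ) u) := by
      refine (continuous_kern ν ς x).comp ?_
      unfold rotate
      simp only [Pi.smul_apply, smul_eq_mul]
      fun_prop
    simpa using (hc.tendsto 0).mono_left nhdsWithin_le_nhds

/-- The support conditions on the weight functions of the terms attached to `ϱ`. -/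
def RegularizationData.Supports {ν : Fin d → ℂ} (R : RegularizationData ν) (ϱ : Fin d → R.ι)
    (l : Fin d) (f : ℝ → ℝ) : Prop :=
  MemT f ∧ (ϱ l ≠ R.pos → VanishTop f) ∧ (ϱ l ≠ R.neg → VanishZero f)

theorem RegularizationData.eulerStable_supports {ν : Fin d → ℂ} (R : RegularizationData ν)
    (ϱ : Fin d → R.ι) : EulerStable (R.Supports ϱ) :=
  fun _ _ hf => ⟨hf.1.eulerOp, fun h => (hf.2.1 h).eulerOp, fun h => (hf.2.2 h).eulerOp⟩

/-- Nonnegativity matters: where one member of the partition is `1`, the others must vanish. This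
gives the supports away from zero and infinity. -/
theorem RegularizationData.eq_zero_of_eq_one {ν : Fin d → ℂ} (R : RegularizationData ν) {i j : R.ι}
    (hij : i ≠ j) {t : ℝ} (ht : 0 < t) (h : R.h j t = 1) : R.h i t = 0 := by
  have h1 := R.sum_eq_one t ht
  rw [← Finset.add_sum_erase _ _ (Finset.mem_univ j), h] at h1
  exact (Finset.sum_eq_zero_iff_of_nonneg fun k _ => R.nonneg k t ht).1
    (by linarith : ∑ k ∈ Finset.univ.erase j, R.h k t = 0) i
    (Finset.mem_erase.2 ⟨hij, Finset.mem_univ _⟩)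

theorem RegularizationData.supports {ν : Fin d → ℂ} (R : RegularizationData ν) (ϱ : Fin d → R.ι)
    (l : Fin d) : R.Supports ϱ l (R.h (ϱ l)) := by
  refine ⟨R.memT _, fun h => ?_, fun h => ?_⟩
  · obtain ⟨K, hK⟩ := eventually_atTop.1 R.pos_eq_one
    refine ⟨max K 1, by positivity, fun t ht => R.eq_zero_of_eq_one h ?_ (hK t ?_)⟩
    · exact one_pos.trans ((le_max_right _ _).trans_lt ht)
    · exact (le_max_left _ _).trans ht.le
  · obtain ⟨K, hK, hK'⟩ := mem_nhdsGT_iff_exists_Ioo_subset.1 R.neg_eq_one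
    exact ⟨K, hK, fun t ht ht' => R.eq_zero_of_eq_one h ht (hK' ⟨ht, ht'⟩)⟩

theorem weights_regularizedPiece {ν : Fin d → ℂ} (R : RegularizationData ν)
    (ς : Fin (d + 1) → ℤˣ) (ϱ : Fin d → R.ι) :
    ∀ T ∈ regularizedPiece R ς ϱ, T.Weights (R.Supports ϱ) := by
  have hs := R.eulerStable_supports ϱ
  have h0 : ∀ T ∈ [({ coeff := 1, deg := 0, shift := 0, h := fun l => R.h (ϱ l) } : JTerm d)],
      T.Weights (R.Supports ϱ) := by
    simpa [JTerm.Weights] using R.supports ϱ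
  unfold regularizedPiece
  dsimp only
  split_ifs
  · intro T hT
    obtain ⟨T₀, h₁, h₂⟩ := List.mem_flatMap.1 hT
    have hT' := hs.opPlusAll _ _ _ h0 T₀ h₁
    exact forall_mem_opPow_const hs.opMinus _ (by simpa using hT') T h₂
  · exact hs.opPlusAll _ _ _ h0

/-- The exponents `2A` and `A + α` are balanced: at `L₋` the shift is at least `α + 2A - (A + α) =
A`, at `L₊` at most `α - (A + α) = -A`. -/
theorem shift_regularizedPiece {ν : Fin d → ℂ} (R : RegularizationData ν)
    (ς : Fin (d + 1) → ℤˣ) (ϱ : Fin d → R.ι) :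
    ∀ T ∈ regularizedPiece R ς ϱ, ∀ l, (ϱ l = R.neg → (R.A : ℤ) ≤ T.shift l) ∧
      (ϱ l = R.pos → T.shift l ≤ -(R.A : ℤ)) := by
  set L : List (Fin d) := (List.finRange d).filter (fun l => ϱ l = R.neg) with hL
  have hcount : ∀ l, ϱ l = R.neg → 1 ≤ L.count l := fun l hl =>
    List.one_le_count_iff.2 (by simp [hL, hl])
  have hcount0 : ∀ l, ϱ l = R.pos → L.count l = 0 := fun l hl =>
    List.count_eq_zero.2 (by simp [hL, hl, R.neg_ne_pos.symm])
  have h1 := fun n => shift_opPlusAll (ν := ν) (ς := ς) n L 0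
    [({ coeff := 1, deg := 0, shift := 0, h := fun l => R.h (ϱ l) } : JTerm d)]
    (by simpa using ⟨0, fun _ => rfl⟩)
  unfold regularizedPiece
  dsimp only
  split_ifs with hpos
  · intro T hT
    obtain ⟨T₀, h₁, h₂⟩ := List.mem_flatMap.1 hT
    obtain ⟨α, hα⟩ := h1 _ T₀ h₁
    have hsel := R.sel_mem ϱ hpos
    -- The index `sel ϱ` lies in `L₊`, where no `e_l` was added, so the shift there is exactly `α`.
    have hαsel := hα (R.sel ϱ)
    rw [hcount0 _ hsel] at hαsel
    obtain ⟨h3, h4⟩ := shift_opPow_opMinus _ _ _ T h₂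
    refine fun l => ⟨fun hl => ?_, fun hl => ?_⟩
    · have hne : l ≠ R.sel ϱ := by
        rintro rfl
        exact R.neg_ne_pos (hl.symm.trans hsel)
      have e1 := h4 l hne
      have e2 := hα l
      have e3 : 2 * R.A * 1 ≤ 2 * R.A * L.count l := Nat.mul_le_mul_left _ (hcount l hl)
      simp only [Pi.zero_apply] at e2 hαsel
      omega
    · have e1 := h3 l
      have e2 := hα l
      rw [hcount0 l hl] at e2
      simp only [Pi.zero_apply] at e2 hαsel
      omega
  · intro T hT l
    refine ⟨fun hl => ?_, fun hl => absurd ⟨l, hl⟩ hpos⟩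
    obtain ⟨α, hα⟩ := h1 _ T hT
    have e2 := hα l
    have e3 : R.A * 1 ≤ R.A * L.count l := Nat.mul_le_mul_left _ (hcount l hl)
    simp only [Pi.zero_apply] at e2
    omega

/-- Since `A > |Re ν_l| + 2`, the shifts make the real exponent at least `1` on `L₋` and at most
`-1` on `L₊`; at all other ends the weight functions vanish. -/
theorem tendsto_rotEval {ς : Fin (d + 1) → ℤˣ} {φ : Fin d → ℝ}
    (hφ : ∀ τ ∈ Ioo (0 : ℝ) 1, Damping ς (τ • φ) 0) {ν : Fin d → ℂ} (R : RegularizationData ν)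
    {x : ℝ} (hx : 0 < x) (ϱ : Fin d → R.ι) {T : JTerm d} (hT : T ∈ regularizedPiece R ς ϱ) :
    Tendsto (fun τ : ℝ => T.rotEval ν ς (τ • φ) x) (𝓝[>] 0) (𝓝 (T.eval ν ς x)) := by
  have hw := weights_regularizedPiece R ς ϱ T hT
  have hs := shift_regularizedPiece R ς ϱ T hT
  have hA := fun l => abs_lt.1 (lt_sub_iff_add_lt.2 (R.lt_A l))
  refine (tendsto_rotJ hφ _ hx (fun l => (hw l).1) (fun l => ?_) fun l => ?_).const_mul _
  · by_cases hl : ϱ l = R.pos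
    · have h1 : (T.shift l : ℝ) ≤ -(R.A : ℝ) := by exact_mod_cast (hs l).2 hl
      have := hA l
      right
      simp
      linarith
    · exact Or.inl ((hw l).2.1 hl)
  · by_cases hl : ϱ l = R.neg
    · have h1 : (R.A : ℝ) ≤ (T.shift l : ℝ) := by exact_mod_cast (hs l).1 hl
      have := hA l
      right
      simp
      linarith
    · exact Or.inl ((hw l).2.2 hl)

theorem tendsto_list_map_sum {α : Type*} {l : Filter ℝ} {f : ℝ → α → ℂ} {g : α → ℂ} (S : List α)
    (h : ∀ T ∈ S, Tendsto (fun τ => f τ T) l (𝓝 (g T))) :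
    Tendsto (fun τ => (S.map (f τ)).sum) l (𝓝 (S.map g).sum) := by
  simpa using tendsto_list_sum S h

/-- The sum over multi-indices factors into the product over `l` of one-variable sums, each equal to
`1`. -/
theorem sum_rotJ_eq {ς : Fin (d + 1) → ℤˣ} {φ : Fin d → ℝ} {b : ℝ} (hφ : Damping ς φ b)
    (hb : 0 < b) {ν : Fin d → ℂ} (R : RegularizationData ν) {x : ℝ} (hx : 0 < x) :
    ∑ ϱ : Fin d → R.ι, rotJ ν ς φ (fun l => R.h (ϱ l)) x = rotJ ν ς φ (fun _ _ => 1) x := by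
  simp only [rotJ_eq]
  rw [← integral_finsetSum _ fun ϱ _ => integrable_rotJ hφ hb ν hx fun l => R.memT (ϱ l)]
  refine integral_congr_ae (ae_of_all _ fun u => ?_)
  beta_reduce
  rw [← Finset.sum_mul]
  congr 1
  simp only [logWeight, ← Fintype.piFinset_univ]
  rw [← Finset.prod_univ_sum (fun _ => Finset.univ) fun l i => ((R.h i (Real.exp (u l)) : ℝ) : ℂ)]
  refine Finset.prod_congr rfl fun l _ => ?_
  rw [← Complex.ofReal_sum, R.sum_eq_one _ (Real.exp_pos _)]

/-- The regularized Bessel function is the limit of the integrals over damping rays. -/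
theorem tendsto_rotJ_one {ς : Fin (d + 1) → ℤˣ} {φ : Fin d → ℝ}
    (hφ : ∀ τ ∈ Ioo (0 : ℝ) 1, ∃ b, 0 < b ∧ Damping ς (τ • φ) b) {ν : Fin d → ℂ}
    (R : RegularizationData ν) {x : ℝ} (hx : 0 < x) :
    Tendsto (fun τ : ℝ => rotJ ν ς (τ • φ) (fun _ _ => 1) x) (𝓝[>] 0) (𝓝 (besselJ R ς x)) := by
  have hφ0 : ∀ τ ∈ Ioo (0 : ℝ) 1, Damping ς (τ • φ) 0 := fun τ hτ => by
    obtain ⟨b, hb, h⟩ := hφ τ hτ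
    exact ⟨hb.le.trans h.1, fun l => hb.le.trans (h.2 l)⟩
  have h1 : Tendsto (fun τ : ℝ => ∑ ϱ : Fin d → R.ι,
      ((regularizedPiece R ς ϱ).map (JTerm.rotEval ν ς (τ • φ) x)).sum) (𝓝[>] 0)
      (𝓝 (besselJ R ς x)) :=
    tendsto_finsetSum _ fun ϱ _ => tendsto_list_map_sum _ fun T hT => tendsto_rotEval hφ0 R hx ϱ hT
  refine h1.congr' ?_
  filter_upwards [Ioo_mem_nhdsGT (zero_lt_one' ℝ)] with τ hτ
  obtain ⟨b, hb, h⟩ := hφ τ hτ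
  rw [← sum_rotJ_eq h hb R hx]
  exact Finset.sum_congr rfl fun ϱ _ => sum_rotEval_regularizedPiece h hb R hx ϱ

/-! ### Independence of the angle -/

theorem logWeight_one (u : Fin d → ℝ) : logWeight (fun _ _ => 1) u = 1 := by simp [logWeight]

theorem integrable_kern {ς : Fin (d + 1) → ℤˣ} {φ : Fin d → ℝ} {b : ℝ} (hφ : Damping ς φ b)
    (hb : 0 < b) (ν : Fin d → ℂ) {x : ℝ} (hx : 0 < x) :
    Integrable fun u => kern ν ς x (rotate φ u) := by
  simpa [logWeight_one] using integrable_rotJ hφ hb ν hx (h := fun _ _ => 1) fun _ => memT_one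

/-- Partial integration with constant weight, whose `t ∂` term is zero: the integrand is a pure
`u_l`-derivative. -/
theorem integral_kern_mul_kernLogDeriv {ς : Fin (d + 1) → ℤˣ} {φ : Fin d → ℝ} {b : ℝ}
    (hφ : Damping ς φ b) (hb : 0 < b) (ν : Fin d → ℂ) {x : ℝ} (hx : 0 < x) (l : Fin d) :
    Integrable (fun u => kern ν ς x (rotate φ u) * kernLogDeriv ν ς x (rotate φ u) l) ∧
      ∫ u, kern ν ς x (rotate φ u) * kernLogDeriv ν ς x (rotate φ u) l = 0 := by
  have hI := rotJ_partial_integration hφ hb (ν := ν) (νp := fun j => ν j + 1)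
    (νm := fun j => ν j - if j = l then 1 else 0) (l := l) (fun _ => rfl) (fun _ => rfl) hx
    (h := fun _ _ => 1) fun _ => memT_one
  have h0 : rotJ ν ς φ (Function.update (fun _ _ => 1) l (eulerOp fun _ => 1)) x = 0 := by
    rw [rotJ_eq]
    refine integral_eq_zero_of_ae (ae_of_all _ fun u => ?_)
    have : logWeight (Function.update (fun _ _ => 1) l (eulerOp fun _ => 1)) u = 0 :=
      Finset.prod_eq_zero (Finset.mem_univ l) (by simp [eulerOp])
    simp [this]
  have i1 := (integrable_kern hφ hb ν hx).const_mul (ν l)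
  have i2 := (integrable_kern hφ hb (fun j => ν j + 1) hx).const_mul (Complex.I * x * sgnLast ς)
  have i3 := (integrable_kern hφ hb (fun j => ν j - if j = l then 1 else 0) hx).const_mul
    (Complex.I * x * sgn ς l)
  simp only [kern_mul_kernLogDeriv (ν := ν) (νp := fun j => ν j + 1)
    (νm := fun j => ν j - if j = l then 1 else 0) (l := l) (fun _ => rfl) (fun _ => rfl)]
  refine ⟨(i1.add i2).sub i3, ?_⟩
  rw [integral_sub (i1.fun_add i2) i3, integral_add i1 i2, integral_const_mul, integral_const_mul,
    integral_const_mul]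
  rw [h0, zero_add] at hI
  simpa [rotJ_eq, logWeight_one] using hI

theorem norm_kernLogDeriv_le (ν : Fin d → ℂ) (ς : Fin (d + 1) → ℤˣ) {x : ℝ} (hx : 0 ≤ x)
    (φ u : Fin d → ℝ) (l : Fin d) :
    ‖kernLogDeriv ν ς x (rotate φ u) l‖ ≤ (‖ν l‖ + 2 * x) * spread u := by
  have h1 : ‖sgnLast ς * Complex.exp (∑ l, rotate φ u l) -
      sgn ς l * Complex.exp (-rotate φ u l)‖ ≤ 2 * spread u := by
    refine (norm_sub_le _ _).trans ?_
    rw [norm_mul, norm_mul, norm_sgn, norm_sgnLast, norm_exp_sum_rotate, norm_exp_neg_rotate]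
    linarith [exp_sum_le_spread u, exp_neg_le_spread u l]
  unfold kernLogDeriv
  refine (norm_add_le _ _).trans ?_
  rw [norm_mul, norm_mul, Complex.norm_I, one_mul, Complex.norm_real, Real.norm_of_nonneg hx]
  have h2 := mul_le_mul_of_nonneg_left h1 hx
  have h3 := mul_le_mul_of_nonneg_left (one_le_spread u) (norm_nonneg (ν l))
  linarith

theorem spread_pow_mul_weight_zero (r : ℝ) (n : ℕ) (b : ℝ) (u : Fin d → ℝ) :
    spread u ^ n * weight r 0 b u = weight r n b u := by
  unfold weight; ring

/-- Cauchy's theorem in infinitesimal form: by holomorphy of `kern`, the `τ`-derivative is `∑ iφ_l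
∂/∂u_l`, and each term integrates to zero. -/
theorem hasDerivAt_rotJ_arg {ς : Fin (d + 1) → ℤˣ} {φ : Fin d → ℝ} {b : ℝ} (hb : 0 < b)
    (hφ : ∀ τ ∈ Ioo (0 : ℝ) 2, Damping ς (τ • φ) (τ * b)) (ν : Fin d → ℂ) {x : ℝ} (hx : 0 < x)
    {τ : ℝ} (hτ : τ ∈ Ioo (0 : ℝ) 2) :
    HasDerivAt (fun τ : ℝ => rotJ ν ς (τ • φ) (fun _ _ => 1) x) 0 τ := by
  obtain ⟨r, hr⟩ := exists_re_bound ν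
  have hτ0 : 0 < τ := hτ.1
  simp only [rotJ_eq, logWeight_one, one_mul]
  have hI := fun l => integral_kern_mul_kernLogDeriv (hφ τ hτ) (mul_pos hτ0 hb) ν hx l
  have hd : ∀ (u : Fin d → ℝ) (s : ℝ), HasDerivAt (fun s : ℝ => kern ν ς x (rotate (s • φ) u))
      (kern ν ς x (rotate (s • φ) u) *
        ∑ l, φ l * Complex.I * kernLogDeriv ν ς x (rotate (s • φ) u) l) s := by
    intro u s
    refine hasDerivAt_kern ν ς x fun l => ?_
    unfold rotate
    refine HasDerivAt.const_add _ (HasDerivAt.mul_const ?_ _)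
    simpa using ((hasDerivAt_id s).mul_const (φ l)).ofReal_comp
  have hsum : ∀ u, kern ν ς x (rotate (τ • φ) u) *
      ∑ l, φ l * Complex.I * kernLogDeriv ν ς x (rotate (τ • φ) u) l =
      ∑ l, φ l * Complex.I *
        (kern ν ς x (rotate (τ • φ) u) * kernLogDeriv ν ς x (rotate (τ • φ) u) l) := by
    intro u
    rw [Finset.mul_sum]
    exact Finset.sum_congr rfl fun l _ => by ring
  have hint : Integrable fun u => kern ν ς x (rotate (τ • φ) u) *
      ∑ l, φ l * Complex.I * kernLogDeriv ν ς x (rotate (τ • φ) u) l := by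
    simp only [hsum]
    exact integrable_finsetSum _ fun l _ => (hI l).1.const_mul _
  have key := hasDerivAt_integral_of_dominated_loc_of_deriv_le (μ := volume)
    (F := fun (s : ℝ) u => kern ν ς x (rotate (s • φ) u)) (x₀ := τ)
    (F' := fun (s : ℝ) u => kern ν ς x (rotate (s • φ) u) *
        ∑ l, φ l * Complex.I * kernLogDeriv ν ς x (rotate (s • φ) u) l)
    -- Staying above `τ / 2` gives a common damping strength, hence one integrable majorant.
    (s := Ioo (τ / 2) 2)
    (bound := fun u => (Real.exp (∑ l, 2 * |(ν l).im * φ l|) *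
      ∑ l, |φ l| * (‖ν l‖ + 2 * x)) * weight r 1 (x * (τ / 2 * b)) u)
    (Ioo_mem_nhds (by linarith) hτ.2)
    (Eventually.of_forall fun s =>
      ((continuous_kern ν ς x).comp (continuous_rotate _)).aestronglyMeasurable)
    (integrable_kern (hφ τ hτ) (mul_pos hτ0 hb) ν hx) hint.aestronglyMeasurable
    (ae_of_all _ fun u s hs => ?_)
    ((integrable_weight r 1 (by positivity)).const_mul _)
    (ae_of_all _ fun u s _ => hd u s)
  · refine key.2.congr_deriv ?_
    simp only [hsum]
    rw [integral_finsetSum _ fun l _ => (hI l).1.const_mul _]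
    refine Finset.sum_eq_zero fun l _ => ?_
    rw [integral_const_mul, (hI l).2, mul_zero]
  · have hs0 : 0 < s := (half_pos hτ0).trans hs.1
    have h1 := (hφ s ⟨hs0, hs.2⟩).norm_kern_le_weight ν hx.le hr u
    have hE : ∑ l, |(ν l).im * (s • φ) l| ≤ ∑ l, 2 * |(ν l).im * φ l| := by
      refine Finset.sum_le_sum fun l _ => ?_
      rw [Pi.smul_apply, smul_eq_mul, mul_left_comm, abs_mul, abs_of_pos hs0]
      exact mul_le_mul_of_nonneg_right hs.2.le (abs_nonneg _)
    have h2 : weight r 0 (x * (s * b)) u ≤ weight r 0 (x * (τ / 2 * b)) u :=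
      weight_anti (by have := hs.1.le; gcongr) _ _ _
    have h3 : ‖∑ l, φ l * Complex.I * kernLogDeriv ν ς x (rotate (s • φ) u) l‖ ≤
        (∑ l, |φ l| * (‖ν l‖ + 2 * x)) * spread u := by
      rw [Finset.sum_mul]
      refine (norm_sum_le _ _).trans (Finset.sum_le_sum fun l _ => ?_)
      rw [norm_mul, norm_mul, Complex.norm_I, mul_one, Complex.norm_real, Real.norm_eq_abs,
        mul_assoc]
      exact mul_le_mul_of_nonneg_left (norm_kernLogDeriv_le ν ς hx.le _ u l) (abs_nonneg _)
    have h4 := weight_nonneg r 0 (x * (s * b)) u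
    rw [norm_mul]
    calc _ ≤ (Real.exp (∑ l, 2 * |(ν l).im * φ l|) * weight r 0 (x * (τ / 2 * b)) u) *
          ((∑ l, |φ l| * (‖ν l‖ + 2 * x)) * spread u) := by
          refine mul_le_mul (h1.trans ?_) h3 (norm_nonneg _)
            (mul_nonneg (Real.exp_pos _).le (weight_nonneg _ _ _ _))
          gcongr
      _ = _ := by
          rw [← spread_pow_mul_weight_zero r 1]
          ring

/-- The Bessel function is an absolutely convergent integral over damping rays. -/
theorem besselJ_eq_rotJ {ς : Fin (d + 1) → ℤˣ} {φ : Fin d → ℝ} {b : ℝ} (hb : 0 < b)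
    (hφ : ∀ τ ∈ Ioo (0 : ℝ) 2, Damping ς (τ • φ) (τ * b)) {ν : Fin d → ℂ}
    (R : RegularizationData ν) {x : ℝ} (hx : 0 < x) :
    besselJ R ς x = rotJ ν ς φ (fun _ _ => 1) x := by
  have h1 := tendsto_rotJ_one (φ := φ) (fun τ hτ => ⟨τ * b, mul_pos hτ.1 hb,
    hφ τ ⟨hτ.1, hτ.2.trans one_lt_two⟩⟩) R hx
  have hd := fun τ hτ => hasDerivAt_rotJ_arg hb hφ ν hx (τ := τ) hτ
  have h2 : Tendsto (fun τ : ℝ => rotJ ν ς (τ • φ) (fun _ _ => 1) x) (𝓝[>] 0)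
      (𝓝 (rotJ ν ς φ (fun _ _ => 1) x)) := by
    refine tendsto_const_nhds.congr' ?_
    filter_upwards [Ioo_mem_nhdsGT (zero_lt_two' ℝ)] with τ hτ
    -- The interval extends to `2` so that the target value `τ = 1` is an interior point.
    have := isOpen_Ioo.is_const_of_deriv_eq_zero isPreconnected_Ioo
      (fun τ hτ => (hd τ hτ).differentiableAt.differentiableWithinAt)
      (fun τ hτ => (hd τ hτ).deriv) (show (1 : ℝ) ∈ Ioo (0 : ℝ) 2 by norm_num) hτ
    simpa using this
  exact tendsto_nhds_unique h1 h2

/-! ### Derivatives in `x` -/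

/-- The `n`-th derivative of the integral over the rays of arguments `φ`. -/
def momentJ (ν : Fin d → ℂ) (ς : Fin (d + 1) → ℤˣ) (φ : Fin d → ℝ) (n : ℕ) (x : ℝ) : ℂ :=
  ∫ u : Fin d → ℝ, (Complex.I * logPhase ς (rotate φ u)) ^ n * kern ν ς x (rotate φ u)

theorem rotJ_one_eq_momentJ (ν : Fin d → ℂ) (ς : Fin (d + 1) → ℤˣ) (φ : Fin d → ℝ) (x : ℝ) :
    rotJ ν ς φ (fun _ _ => 1) x = momentJ ν ς φ 0 x := by
  simp [rotJ_eq, logWeight_one, momentJ]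

theorem Damping.norm_moment_le {ς : Fin (d + 1) → ℤˣ} {φ : Fin d → ℝ} {b : ℝ}
    (hφ : Damping ς φ b) (ν : Fin d → ℂ) {x : ℝ} (hx : 0 ≤ x) {r : ℝ} (hr : ∀ l, |(ν l).re| ≤ r)
    (n : ℕ) (u : Fin d → ℝ) :
    ‖(Complex.I * logPhase ς (rotate φ u)) ^ n * kern ν ς x (rotate φ u)‖ ≤
      Real.exp (∑ l, |(ν l).im * φ l|) * weight r n (x * b) u := by
  rw [norm_mul, norm_pow, norm_mul, Complex.norm_I, one_mul]
  calc _ ≤ spread u ^ n * (Real.exp (∑ l, |(ν l).im * φ l|) * weight r 0 (x * b) u) := by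
        have := zero_le_one.trans (one_le_spread u)
        gcongr
        · exact norm_logPhase_le ς φ u
        · exact hφ.norm_kern_le_weight ν hx hr u
    _ = _ := by rw [← spread_pow_mul_weight_zero r n]; ring

/-- Each derivative brings down `i θ`, of size at most `spread u`. On `y > x / 2` the damping is at
least half of that at `x`, which gives a common majorant. -/
theorem hasDerivAt_momentJ {ς : Fin (d + 1) → ℤˣ} {φ : Fin d → ℝ} {b : ℝ} (hb : 0 < b)
    (hφ : Damping ς φ b) (ν : Fin d → ℂ) (n : ℕ) {x : ℝ} (hx : 0 < x) :
    HasDerivAt (momentJ ν ς φ n) (momentJ ν ς φ (n + 1) x) x := by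
  obtain ⟨r, hr⟩ := exists_re_bound ν
  have hmeas : ∀ (n : ℕ) (x : ℝ), AEStronglyMeasurable (fun u : Fin d → ℝ =>
      (Complex.I * logPhase ς (rotate φ u)) ^ n * kern ν ς x (rotate φ u)) volume := fun n x =>
    (((continuous_const.mul ((continuous_logPhase ς).comp (continuous_rotate φ))).pow n).mul
      ((continuous_kern ν ς x).comp (continuous_rotate φ))).aestronglyMeasurable
  refine (hasDerivAt_integral_of_dominated_loc_of_deriv_le (μ := volume) (s := Ioi (x / 2))
    (F := fun (x : ℝ) u => (Complex.I * logPhase ς (rotate φ u)) ^ n * kern ν ς x (rotate φ u))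
    (F' := fun (x : ℝ) u =>
      (Complex.I * logPhase ς (rotate φ u)) ^ (n + 1) * kern ν ς x (rotate φ u))
    (bound := fun u => Real.exp (∑ l, |(ν l).im * φ l|) * weight r (n + 1) (x / 2 * b) u)
    (Ioi_mem_nhds (half_lt_self hx)) (Eventually.of_forall fun x => hmeas n x)
    (((integrable_weight r n (mul_pos hx hb)).const_mul _).mono' (hmeas n x)
      (ae_of_all _ (hφ.norm_moment_le ν hx.le hr n))) (hmeas (n + 1) x)
    (ae_of_all _ fun u y hy => ?_)
    ((integrable_weight r (n + 1) (by positivity)).const_mul _)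
    (ae_of_all _ fun u y _ => ?_)).2
  · have hy : x / 2 < y := hy
    refine (hφ.norm_moment_le ν ((half_pos hx).trans hy).le hr (n + 1) u).trans ?_
    exact mul_le_mul_of_nonneg_left (weight_anti (by gcongr) _ _ _) (Real.exp_pos _).le
  · have h1 : HasDerivAt (fun y : ℝ => Complex.I * (y : ℂ) * logPhase ς (rotate φ u))
        (Complex.I * 1 * logPhase ς (rotate φ u)) y :=
      ((hasDerivAt_id y).ofReal_comp.const_mul Complex.I).mul_const _
    refine ((h1.const_add _).cexp.const_mul _).congr_deriv ?_
    rw [kern]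
    ring

/-! ### Choice of the angles -/

/-- Damping arguments exist when one of the first `d` signs differs from the last one. -/
theorem exists_damping {ς : Fin (d + 1) → ℤˣ} {k : Fin d} (hk : ς k.castSucc ≠ ς (Fin.last d))
    {δ : ℝ} (hδ : 0 < δ) (hδ' : 4 * d * δ ≤ 1) :
    ∃ φ : Fin d → ℝ, (∀ τ ∈ Ioo (0 : ℝ) 2, Damping ς (τ • φ) (τ * (δ / 2))) ∧
      ∀ l, |φ l| ≤ d * δ := by
  have hd : (1 : ℝ) ≤ d := by exact_mod_cast k.pos
  set e : Fin d → ℝ := fun l => ((ς l.castSucc : ℤ) : ℝ) with he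
  set e' : ℝ := ((ς (Fin.last d) : ℤ) : ℝ) with he'
  have hcast : ∀ z : ℤˣ, ((z : ℤ) : ℝ) = 1 ∨ ((z : ℤ) : ℝ) = -1 := fun z => by
    rcases Int.units_eq_one_or z with h | h <;> simp [h]
  have hel : ∀ l, e l = 1 ∨ e l = -1 := fun l => hcast _
  have hee : ∀ l, -1 ≤ e' * e l ∧ e' * e l ≤ 1 := fun l => by
    rcases hel l with h | h <;> rcases hcast (ς (Fin.last d)) with h' | h' <;>
      rw [h, he', h'] <;> norm_num
  have hek : e' * e k = -1 := by
    rw [he, he']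
    dsimp only
    rw [Int.units_ne_iff_eq_neg.1 hk]
    rcases Int.units_eq_one_or (ς (Fin.last d)) with h | h <;> simp [h]
  -- Weight `dδ` at `k` outweighs the other `d - 1` weights `δ`, whatever their signs.
  set w : Fin d → ℝ := fun l => if l = k then d * δ else δ with hw
  have hw0 : ∀ l, δ ≤ w l := fun l => by
    rw [hw]; dsimp only; split_ifs
    · nlinarith
    · exact le_rfl
  have hw1 : ∀ l, w l ≤ d * δ := fun l => by
    rw [hw]; dsimp only; split_ifs
    · exact le_rfl
    · nlinarith
  -- Jordan's inequality `sin y ≥ 2y/π`, with `π ≤ 4`.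
  have hsin : ∀ y : ℝ, 0 ≤ y → y ≤ 1 → y / 2 ≤ Real.sin y := fun y h0 h1 => by
    have hpi := Real.pi_gt_three
    refine le_trans ?_ (Real.mul_le_sin h0 (by linarith))
    have : 1 / 2 ≤ 2 / Real.pi := by
      rw [div_le_div_iff₀ two_pos Real.pi_pos]; linarith [Real.pi_le_four]
    nlinarith
  set S : ℝ := ∑ l, -(e' * e l) * w l with hS
  have hSk : S = d * δ + ∑ l ∈ Finset.univ.erase k, -(e' * e l) * w l := by
    rw [hS, ← Finset.add_sum_erase _ _ (Finset.mem_univ k), hek]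
    simp [hw]
  have hcard : ((Finset.univ.erase k).card : ℝ) = d - 1 := by
    rw [Finset.card_erase_of_mem (Finset.mem_univ k), Finset.card_univ, Fintype.card_fin,
      Nat.cast_sub k.pos]
    simp
  have hwe : ∀ l ∈ Finset.univ.erase k, w l = δ := fun l hl => by
    simp [hw, Finset.ne_of_mem_erase hl]
  -- In the worst case the sum is `dδ - (d - 1)δ = δ`.
  have hS0 : δ ≤ S := by
    have : ∑ l ∈ Finset.univ.erase k, -δ ≤ ∑ l ∈ Finset.univ.erase k, -(e' * e l) * w l :=
      Finset.sum_le_sum fun l hl => by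
        rw [hwe l hl]; nlinarith [(hee l).2]
    rw [Finset.sum_const, nsmul_eq_mul, hcard] at this
    linarith
  have hS1 : S ≤ 2 * d * δ := by
    have : ∑ l ∈ Finset.univ.erase k, -(e' * e l) * w l ≤ ∑ l ∈ Finset.univ.erase k, δ :=
      Finset.sum_le_sum fun l hl => by
        rw [hwe l hl]; nlinarith [(hee l).1]
    rw [Finset.sum_const, nsmul_eq_mul, hcard] at this
    linarith
  have hodd : ∀ s y : ℝ, s = 1 ∨ s = -1 → s * Real.sin (s * y) = Real.sin y := by
    rintro s y (rfl | rfl) <;> simp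
  refine ⟨fun l => -(e l * w l), fun τ hτ => ⟨?_, fun l => ?_⟩, fun l => ?_⟩
  · have e1 : ∑ l, (τ • fun l => -(e l * w l)) l = e' * (τ * S) := by
      have h2 : e' * e' = 1 := by
        rcases hcast (ς (Fin.last d)) with h' | h' <;> rw [he', h'] <;> norm_num
      simp only [hS, Finset.mul_sum, Pi.smul_apply, smul_eq_mul]
      refine Finset.sum_congr rfl fun l _ => ?_
      linear_combination (τ * e l * w l) * h2
    rw [e1, hodd _ _ (hcast _)]
    -- Here `τS ≤ 2 · 2dδ ≤ 1`, which is what `4dδ ≤ 1` is for.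
    have h3 := hsin (τ * S) (mul_nonneg hτ.1.le (hδ.le.trans hS0)) (by nlinarith [hτ.1, hτ.2])
    have h4 := mul_le_mul_of_nonneg_left hS0 hτ.1.le
    linarith
  · have e1 : (τ • fun l => -(e l * w l)) l = -(e l * (τ * w l)) := by
      simp only [Pi.smul_apply, smul_eq_mul]; ring
    rw [e1, Real.sin_neg, mul_neg, neg_neg, hodd _ _ (hcast _)]
    have h3 := hsin (τ * w l) (mul_nonneg hτ.1.le (hδ.le.trans (hw0 l)))
      (by nlinarith [hτ.1, hτ.2, hw0 l, hw1 l])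
    have h4 := mul_le_mul_of_nonneg_left (hw0 l) hτ.1.le
    linarith
  · rw [abs_neg, abs_mul, abs_of_nonneg (hδ.le.trans (hw0 l))]
    rcases hel l with h | h <;> rw [h] <;> simpa using hw1 l

/-! ### Uniform decay -/

theorem norm_le_conductor (ν : Fin d → ℂ) (l : Fin d) : ‖ν l‖ ≤ conductor ν :=
  (le_ciSup (f := fun l => ‖ν l‖) (Set.finite_range _).bddAbove l).trans
    (le_add_of_nonneg_right zero_le_one)

theorem one_le_conductor (ν : Fin d → ℂ) : 1 ≤ conductor ν :=
  le_add_of_nonneg_left (Real.iSup_nonneg fun _ => norm_nonneg _)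

theorem abs_re_le_maxRe (ν : Fin d → ℂ) (l : Fin d) : |(ν l).re| ≤ maxRe ν :=
  le_ciSup (f := fun l => |(ν l).re|) (Set.finite_range _).bddAbove l

/-- The implied constant in the estimate of the derivatives. -/
def decayConst (r : ℝ) (M j d : ℕ) : ℝ :=
  Real.exp 1 * (M.factorial / (1 / (16 * (d : ℝ) ^ 2)) ^ M) *
    ∫ u : Fin d → ℝ, weight r j (1 / (16 * (d : ℝ) ^ 2)) u

/-- For `y, s ≥ 1` one has `2ys ≥ y + s`. This splits the damping into decay in `y = x/𝔠` and an
integrable factor free of `x` and `𝔠`. -/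
theorem weight_mul_le {a y : ℝ} (ha : 0 ≤ a) (hy : 1 ≤ y) (r : ℝ) (n : ℕ) (u : Fin d → ℝ) :
    weight r n (y * (2 * a)) u ≤ Real.exp (-(a * y)) * weight r n a u := by
  have hs := one_le_spread u
  have : Real.exp (-(y * (2 * a) * spread u)) ≤
      Real.exp (-(a * y)) * Real.exp (-(a * spread u)) := by
    rw [← Real.exp_add, Real.exp_le_exp]
    nlinarith [mul_nonneg ha (mul_nonneg (zero_le_one.trans hy) (sub_nonneg.2 hs)),
      mul_nonneg ha (mul_nonneg (zero_le_one.trans hs) (sub_nonneg.2 hy))]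
  unfold weight
  calc _ ≤ Real.exp (r * ∑ l, |u l|) * spread u ^ n *
        (Real.exp (-(a * y)) * Real.exp (-(a * spread u))) := by gcongr
    _ = _ := by ring

theorem norm_momentJ_le {ς : Fin (d + 1) → ℤˣ} {φ : Fin d → ℝ} {ν : Fin d → ℂ} (hd : 0 < d)
    (hφ : Damping ς φ (1 / (4 * (d : ℝ) ^ 2 * conductor ν) / 2))
    (hφ' : ∀ l, |φ l| ≤ d * (1 / (4 * (d : ℝ) ^ 2 * conductor ν))) (M j : ℕ) {x : ℝ}
    (hx : conductor ν ≤ x) :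
    ‖momentJ ν ς φ j x‖ ≤ decayConst (maxRe ν) M j d * (conductor ν / x) ^ M := by
  have hc := one_le_conductor ν
  have hc0 : 0 < conductor ν := by linarith
  have hd0 : (0 : ℝ) < d := by exact_mod_cast hd
  have hx0 : 0 < x := hc0.trans_le hx
  set a : ℝ := 1 / (16 * (d : ℝ) ^ 2) with ha
  have ha0 : 0 < a := by positivity
  have hy : 1 ≤ x / conductor ν := (one_le_div hc0).2 hx
  -- The damping strength is `δ/2 = 1/(8d²𝔠) = 2a/𝔠`, in the form that `weight_mul_le` requires.
  have hb : x * (1 / (4 * (d : ℝ) ^ 2 * conductor ν) / 2) = x / conductor ν * (2 * a) := by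
    rw [ha]; field_simp; norm_num
  -- Each summand is at most `𝔠 · dδ = 1/(4d)`, so the price of rotation is at most `e`, uniformly
  -- in `Im ν`.
  have hE : ∑ l, |(ν l).im * φ l| ≤ 1 := by
    have : ∑ l, |(ν l).im * φ l| ≤ ∑ _l : Fin d, 1 / (4 * (d : ℝ)) := by
      refine Finset.sum_le_sum fun l _ => ?_
      rw [abs_mul]
      calc _ ≤ conductor ν * (d * (1 / (4 * (d : ℝ) ^ 2 * conductor ν))) :=
            mul_le_mul ((Complex.abs_im_le_norm _).trans (norm_le_conductor ν l)) (hφ' l)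
              (abs_nonneg _) hc0.le
        _ = _ := by field_simp
    refine this.trans ?_
    rw [Finset.sum_const, Finset.card_univ, Fintype.card_fin, nsmul_eq_mul]
    field_simp
    norm_num
  have hexp : Real.exp (-(a * (x / conductor ν))) ≤
      M.factorial / a ^ M * (conductor ν / x) ^ M := by
    have h1 := pow_mul_exp_neg_le ha0 (zero_le_one.trans hy) M
    have h2 : 0 < (x / conductor ν) ^ M := by positivity
    rw [show conductor ν / x = (x / conductor ν)⁻¹ from (inv_div _ _).symm, inv_pow, ← div_eq_mul_inv, le_div_iff₀ h2]
    linarith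
  have hw := integrable_weight (d := d) (maxRe ν) j ha0
  have hw0 : 0 ≤ ∫ u : Fin d → ℝ, weight (maxRe ν) j a u :=
    integral_nonneg fun u => weight_nonneg _ _ _ u
  calc ‖momentJ ν ς φ j x‖
      ≤ ∫ u : Fin d → ℝ, Real.exp 1 *
          (Real.exp (-(a * (x / conductor ν))) * weight (maxRe ν) j a u) := by
        refine norm_integral_le_of_norm_le ((hw.const_mul _).const_mul _) (ae_of_all _ fun u => ?_)
        refine (hφ.norm_moment_le ν hx0.le (abs_re_le_maxRe ν) j u).trans ?_
        rw [hb]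
        exact mul_le_mul (Real.exp_le_exp.2 hE) (weight_mul_le ha0.le hy _ _ _)
          (weight_nonneg _ _ _ _) (Real.exp_pos _).le
    _ = Real.exp 1 * Real.exp (-(a * (x / conductor ν))) * ∫ u, weight (maxRe ν) j a u := by
        rw [integral_const_mul, integral_const_mul, mul_assoc]
    _ ≤ Real.exp 1 * (M.factorial / a ^ M * (conductor ν / x) ^ M) *
          ∫ u, weight (maxRe ν) j a u := by gcongr
    _ = _ := by rw [decayConst]; ring

theorem iteratedDeriv_eq_of_hasDerivAt {f : ℝ → ℂ} {F : ℕ → ℝ → ℂ}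
    (h0 : ∀ x, 0 < x → f x = F 0 x) (h : ∀ n x, 0 < x → HasDerivAt (F n) (F (n + 1) x) x) (n : ℕ) :
    ∀ x, 0 < x → iteratedDeriv n f x = F n x := by
  induction n with
  | zero => simpa using h0
  | succ n ih =>
    intro x hx
    have he : iteratedDeriv n f =ᶠ[𝓝 x] F n := by
      filter_upwards [Ioi_mem_nhds hx] with y hy using ih y hy
    rw [iteratedDeriv_succ, he.deriv_eq, (h n x hx).deriv]

theorem contDiffOn_of_hasDerivAt {f : ℝ → ℂ} {F : ℕ → ℝ → ℂ}
    (h0 : ∀ x, 0 < x → f x = F 0 x) (h : ∀ n x, 0 < x → HasDerivAt (F n) (F (n + 1) x) x) :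
    ContDiffOn ℝ ∞ f (Ioi 0) := by
  refine contDiffOn_of_differentiableOn_deriv fun n _ => ?_
  refine DifferentiableOn.congr (f := F n)
    (fun x hx => (h n x hx).differentiableAt.differentiableWithinAt) fun x hx => ?_
  rw [iteratedDerivWithin_of_isOpen isOpen_Ioi hx]
  exact iteratedDeriv_eq_of_hasDerivAt h0 h n x hx

theorem isSchwartzAtInfinity_of_bound {f : ℝ → ℂ} {c : ℝ} (hc : 0 < c) {C : ℕ → ℕ → ℝ}
    (h : ∀ (M j : ℕ) (x : ℝ), c ≤ x → ‖iteratedDeriv j f x‖ ≤ C M j * (c / x) ^ M) :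
    IsSchwartzAtInfinity f := by
  intro j N
  refine Asymptotics.IsBigO.of_bound (C N j * c ^ N) ?_
  filter_upwards [eventually_ge_atTop c] with x hx
  have hx0 : 0 < x := hc.trans_le hx
  refine (h N j x hx).trans (le_of_eq ?_)
  rw [Real.norm_of_nonneg (by positivity), div_pow]
  ring

end FundamentalBessel

end

theorem mainTheorem11 :
    ∃ C : ℝ → ℕ → ℕ → ℕ → ℝ,
      ∀ (d : ℕ) (ν : Fin d → ℂ) (ς : Fin (d + 1) → ℤˣ)
        (R : FundamentalBessel.RegularizationData ν),
        (∃ k : Fin d, ς k.castSucc ≠ ς (Fin.last d)) →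
          ContDiffOn ℝ ∞ (FundamentalBessel.besselJ R ς) (Ioi 0) ∧
          (∀ (M j : ℕ) (x : ℝ), FundamentalBessel.conductor ν ≤ x →
            ‖iteratedDeriv j (FundamentalBessel.besselJ R ς) x‖ ≤
              C (FundamentalBessel.maxRe ν) M j d * (FundamentalBessel.conductor ν / x) ^ M) ∧
          FundamentalBessel.IsSchwartzAtInfinity (FundamentalBessel.besselJ R ς) := by
  refine ⟨FundamentalBessel.decayConst, fun d ν ς R ⟨k, hk⟩ => ?_⟩
  have hc := FundamentalBessel.one_le_conductor ν
  have hc0 : 0 < FundamentalBessel.conductor ν := by linarith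
  have hd : (1 : ℝ) ≤ d := by exact_mod_cast k.pos
  -- The choice `δ = 1/(4d²𝔠)` gives both `4dδ = 1/(d𝔠) ≤ 1` and angles at most `dδ = 1/(4d𝔠)`.
  have hδ : 0 < 1 / (4 * (d : ℝ) ^ 2 * FundamentalBessel.conductor ν) := by positivity
  obtain ⟨φ, hφ, hφ'⟩ := FundamentalBessel.exists_damping hk hδ (by
    rw [mul_one_div, div_le_one (by positivity)]
    nlinarith [mul_le_mul hd hc zero_le_one (zero_le_one.trans hd)])
  have hφ1 := hφ 1 (by norm_num)
  rw [one_smul, one_mul] at hφ1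
  have h0 : ∀ x, 0 < x → FundamentalBessel.besselJ R ς x =
      FundamentalBessel.momentJ ν ς φ 0 x := fun x hx => by
    rw [FundamentalBessel.besselJ_eq_rotJ (half_pos hδ) hφ R hx,
      FundamentalBessel.rotJ_one_eq_momentJ]
  have h1 := fun n x (hx : 0 < x) =>
    FundamentalBessel.hasDerivAt_momentJ (half_pos hδ) hφ1 ν n hx
  have h2 : ∀ (M j : ℕ) (x : ℝ), FundamentalBessel.conductor ν ≤ x →
      ‖iteratedDeriv j (FundamentalBessel.besselJ R ς) x‖ ≤
        FundamentalBessel.decayConst (FundamentalBessel.maxRe ν) M j d *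
          (FundamentalBessel.conductor ν / x) ^ M := fun M j x hx => by
    rw [FundamentalBessel.iteratedDeriv_eq_of_hasDerivAt h0 h1 j x (hc0.trans_le hx)]
    exact FundamentalBessel.norm_momentJ_le k.pos hφ1 hφ' M j hx
  exact ⟨FundamentalBessel.contDiffOn_of_hasDerivAt h0 h1, h2,
    FundamentalBessel.isSchwartzAtInfinity_of_bound hc0
      (C := fun M j => FundamentalBessel.decayConst (FundamentalBessel.maxRe ν) M j d) h2⟩
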